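/- **Setting.** Let $d,n,k\ge 0$ be integers, let $\mathcal P^n$ be the space of real polynomials in $X=(X_1,\dots,X_d)$ of total degree at most $n$, and let $g_1,\dots,g_k$ be real polynomials in $X$ with $\mathbb K=\{x\in\mathbb R^d : g_j(x)\ge 0,\ 1\le j\le k\}$. Put $n_j=\lfloor (n-\deg g_j)/2\rfloor$, with $\mathcal P^{n_j}=\{0\}$ if $\deg g_j>n$ and with $\deg g_j=0$ if $g_j=0$. An *SOS decomposition* of a polynomial $p$ is an identity $p=\sum_{j} g_j\sum_i q_{ij}^2$ with finitely many indices $i$ and $q_{ij}\in\mathcal P^{n_j}$. Let $$B(X)=\mathrm{diag}\big(g_j(X)\,(X^\alpha X^\beta)_{|\alpha|,|\beta|\le n_j}\big)_{1\le j\le k},\qquad p_B=\operatorname{tr}B(X).$$ Let $x_1,\dots,x_r\in\mathbb R^d$ be unisolvent for $\mathcal P^n$, i.e. $r=\dim\mathcal P^n$ and every polynomial in $\mathcal P^n$ is determined by its values at these points, and let $B_s=B(x_s)$. For $\lambda\in\mathbb R^r$ put $M(\lambda)=I+\sum_s\lambda_sB_s$, let $\mathcal D=\{\lambda\in\mathbb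 R^r : M(\lambda)\succ0\}$, and for a polynomial $p$ let $G=G_p$ be given by $$G(\lambda)=\operatorname{tr}\big(M(\lambda)^{-1}\big)+\sum_{s=1}^r p(x_s)\lambda_s\quad(\lambda\in\mathcal D),\qquad G(\lambda)=+\infty\quad(\lambda\notin\mathcal D).$$ For $\lambda\in\mathcal D$ and for each column $i$ of $M(\lambda)^{-1}$, let $q_{ij}[\lambda]=\sum_{|\alpha|\le n_j}\big(M(\lambda)^{-1}\big)_{(j,\alpha),i}X^\alpha\in\mathcal P^{n_j}$. We say that *the minimizer for $p$ yields an SOS decomposition* if - $G_p$ has exactly one minimizer $\lambda_*$ in $\mathcal D$; - $p=\sum_{j}g_j\sum_i q_{ij}[\lambda_*]^2$, and this is an SOS decomposition of $p$; - $\lambda_*$ is computed by descent: for all $0<a\le b$ there is $\tau_{\max}>0$ such that for every $\tau_{\min}>0$, all steps $\tau_m\in[\tau_{\min},\tau_{\max}]$ and all symmetric matrices $H_m$ with $aI\preceq H_m\preceq bI$, the iteration $\lambda^0=0$, $\lambda^{m+1}=\lambda^m-\tau_mH_m^{-1}\nabla G_p(\lambda^m)$ stays in $\mathcal D$ and converges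 to $\lambda_*$, and the coefficients of each $q_{ij}[\lambda^m]$ converge to those of $q_{ij}[\lambda_*]$. **Statement.** 1. Let $p\in\mathcal P^n$ be nonnegative on $\mathbb K$ and have an SOS decomposition, and assume that the matrices $B_1,\dots,B_r$ are linearly independent. Then for every $\varepsilon>0$ the minimizer for $p^\varepsilon=p+\varepsilon p_B$ (that is, the minimizer of $G^\varepsilon=G_{p^\varepsilon}$) yields an SOS decomposition of $p^\varepsilon$. 2. Let $d=1$, $a<b$, and take the weights $g_1=1$, $g_2=(X-a)(b-X)$ if $n$ is even, and $g_1=X-a$, $g_2=b-X$ if $n$ is odd, so that $\mathbb K=[a,b]$. Let $x_1,\dots,x_{n+1}$ be distinct real numbers and let $p\in\mathcal P^n$ satisfy $p>0$ on $[a,b]$. Then the minimizer for $p$ yields an SOS decomposition of $p$. -/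

import Mathlib

noncomputable section

namespace SOSDual

open MvPolynomial

variable {d k r : ℕ}

/-- Real polynomials in `d` variables of total degree at most `n`. -/
abbrev polySpace (d n : ℕ) : Submodule ℝ (MvPolynomial (Fin d) ℝ) :=
  restrictTotalDegree (Fin d) ℝ n

/-- The closed semi-algebraic set `{x | g_j(x) ≥ 0 for all j}`. -/
def semialgSet (g : Fin k → MvPolynomial (Fin d) ℝ) : Set (Fin d → ℝ) :=
  {x | ∀ j, 0 ≤ eval x (g j)}

/-- Polynomials of total degree at most `n` that are nonnegative on `K`. -/
def nonnegPolys (n : ℕ) (K : Set (Fin d → ℝ)) : Set (MvPolynomial (Fin d) ℝ) :=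
  {p | p ∈ polySpace d n ∧ ∀ x ∈ K, 0 ≤ eval x p}

/-- Unisolvent points: there are `dim P^n` of them, and a polynomial of degree at most `n` is
uniquely determined by its values at them. -/
def IsUnisolvent (n : ℕ) (x : Fin r → Fin d → ℝ) : Prop :=
  r = Module.finrank ℝ (polySpace d n) ∧
    ∀ p ∈ polySpace d n, ∀ q ∈ polySpace d n, (∀ s, eval (x s) p = eval (x s) q) → p = q

/-- The multi-indices `α` with `|α| ≤ ⌊(n - deg g) / 2⌋` (none if `deg g > n`). -/
abbrev ExpIdx (n : ℕ) (g : MvPolynomial (Fin d) ℝ) : Type :=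
  {α : Fin d →₀ ℕ // 2 * α.degree + g.totalDegree ≤ n}

instance (n : ℕ) (g : MvPolynomial (Fin d) ℝ) : Finite (ExpIdx n g) :=
  Set.Finite.subset (Finsupp.finite_of_degree_le n) (fun α hα => by
    have h : 2 * α.degree + g.totalDegree ≤ n := hα
    show α.degree ≤ n
    omega)

instance (n : ℕ) (g : MvPolynomial (Fin d) ℝ) : Fintype (ExpIdx n g) := Fintype.ofFinite _

/-- Index set of the coordinates of a Cholesky factor: pairs `(j, α)`. -/
abbrev CholIdx (g : Fin k → MvPolynomial (Fin d) ℝ) (n : ℕ) : Type :=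
  Σ j : Fin k, ExpIdx n (g j)

/-- `p = ∑_j g_j ∑_i q_ij²` where `deg q_ij ≤ ⌊(n - deg g_j) / 2⌋` (and `q_ij = 0` if
`deg g_j > n`). -/
def IsSOSDecomposition {I : Type} [Fintype I] (g : Fin k → MvPolynomial (Fin d) ℝ) (n : ℕ)
    (p : MvPolynomial (Fin d) ℝ) (q : I → Fin k → MvPolynomial (Fin d) ℝ) : Prop :=
  (∀ i j, q i j ≠ 0 → 2 * (q i j).totalDegree + (g j).totalDegree ≤ n) ∧
    p = ∑ j, g j * ∑ i, q i j ^ 2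

/-- The polynomial valued block diagonal matrix `B(X)`, whose `j`-th block is
`g_j(X) (X^α X^β)_{α, β}`. -/
def matB (g : Fin k → MvPolynomial (Fin d) ℝ) (n : ℕ) :
    Matrix (CholIdx g n) (CholIdx g n) (MvPolynomial (Fin d) ℝ) :=
  Matrix.blockDiagonal' fun j =>
    Matrix.of fun α β : ExpIdx n (g j) => g j * (monomial α.1 1 * monomial β.1 1)

/-- The real matrix `B(x)` at a point `x`. -/
def matBAt (g : Fin k → MvPolynomial (Fin d) ℝ) (n : ℕ) (x : Fin d → ℝ) :
    Matrix (CholIdx g n) (CholIdx g n) ℝ :=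
  (matB g n).map (eval x)

/-- The polynomial `p_B = tr B(X)`. -/
def polyB (g : Fin k → MvPolynomial (Fin d) ℝ) (n : ℕ) : MvPolynomial (Fin d) ℝ :=
  (matB g n).trace

/-- `M(λ) = I + ∑_s λ_s B(x_s)`. -/
def matM (g : Fin k → MvPolynomial (Fin d) ℝ) (n : ℕ) (x : Fin r → Fin d → ℝ)
    (lam : Fin r → ℝ) : Matrix (CholIdx g n) (CholIdx g n) ℝ :=
  1 + ∑ s, lam s • matBAt g n (x s)

/-- The domain `D` of positive definiteness of `M`. -/
def domD (g : Fin k → MvPolynomial (Fin d) ℝ) (n : ℕ) (x : Fin r → Fin d → ℝ) :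
    Set (Fin r → ℝ) :=
  {lam | (matM g n x lam).PosDef}

/-- The formula `tr M(λ)⁻¹ + ∑_s y_s λ_s`, which is meaningful on `D`. -/
def valG (g : Fin k → MvPolynomial (Fin d) ℝ) (n : ℕ) (x : Fin r → Fin d → ℝ)
    (y : Fin r → ℝ) (lam : Fin r → ℝ) : ℝ :=
  ((matM g n x lam)⁻¹).trace + ∑ s, y s * lam s

open Classical in
/-- The function `G`, with value `+∞` outside of `D`. -/
def funG (g : Fin k → MvPolynomial (Fin d) ℝ) (n : ℕ) (x : Fin r → Fin d → ℝ)
    (y : Fin r → ℝ) (lam : Fin r → ℝ) : EReal :=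
  if lam ∈ domD g n x then (valG g n x y lam : EReal) else ⊤

/-- The gradient of `G` (used at points of the open set `D`). -/
def gradG (g : Fin k → MvPolynomial (Fin d) ℝ) (n : ℕ) (x : Fin r → Fin d → ℝ)
    (y : Fin r → ℝ) (lam : Fin r → ℝ) : Fin r → ℝ :=
  fun s => fderiv ℝ (valG g n x y) lam (Pi.single s 1)

/-- The polynomials `q_ij[λ]`, whose coefficients are read off the `i`-th column of `M(λ)⁻¹`. -/
def polyQ (g : Fin k → MvPolynomial (Fin d) ℝ) (n : ℕ) (x : Fin r → Fin d → ℝ)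
    (lam : Fin r → ℝ) (i : CholIdx g n) (j : Fin k) : MvPolynomial (Fin d) ℝ :=
  ∑ α : ExpIdx n (g j), monomial α.1 ((matM g n x lam)⁻¹ ⟨j, α⟩ i)

/-- `lamStar` is computed by descent: whenever `0 < a ≤ b`, the iteration
`λ^{m+1} = λ^m - τ_m H_m⁻¹ ∇G(λ^m)`, `λ^0 = 0`, with any symmetric matrices `a I ≤ H_m ≤ b I` and
any steps `τ_m` that are bounded below by a positive number and above by a threshold, stays in `D`
and converges to `lamStar`, and the polynomials `q_ij[λ^m]` converge (coefficientwise) to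
`q_ij[lamStar]`. -/
def DescentConverges (g : Fin k → MvPolynomial (Fin d) ℝ) (n : ℕ) (x : Fin r → Fin d → ℝ)
    (y : Fin r → ℝ) (lamStar : Fin r → ℝ) : Prop :=
  ∀ a b : ℝ, 0 < a → a ≤ b → ∃ τmax : ℝ, 0 < τmax ∧
    ∀ (τmin : ℝ) (τ : ℕ → ℝ) (H : ℕ → Matrix (Fin r) (Fin r) ℝ) (lam : ℕ → Fin r → ℝ),
      0 < τmin → (∀ m, τmin ≤ τ m ∧ τ m ≤ τmax) →
      (∀ m, (H m - a • (1 : Matrix (Fin r) (Fin r) ℝ)).PosSemidef ∧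
        (b • (1 : Matrix (Fin r) (Fin r) ℝ) - H m).PosSemidef) →
      lam 0 = 0 →
      (∀ m, lam (m + 1) = lam m - τ m • ((H m)⁻¹).mulVec (gradG g n x y (lam m))) →
      (∀ m, lam m ∈ domD g n x) ∧
        Filter.Tendsto lam Filter.atTop (nhds lamStar) ∧
        ∀ i j γ, Filter.Tendsto (fun m => coeff γ (polyQ g n x (lam m) i j)) Filter.atTop
          (nhds (coeff γ (polyQ g n x lamStar i j)))

/-- `G`, built from the points `x_s` and the data `p(x_s)`, has exactly one minimizer in `D`, this
minimizer `λ` yields the SOS decomposition `p = ∑_j g_j ∑_i q_ij[λ]²`, and it is computed by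
descent. -/
def MinimizerYieldsSOS (g : Fin k → MvPolynomial (Fin d) ℝ) (n : ℕ) (x : Fin r → Fin d → ℝ)
    (p : MvPolynomial (Fin d) ℝ) : Prop :=
  ∃ lam ∈ domD g n x,
    IsMinOn (funG g n x fun s => eval (x s) p) (domD g n x) lam ∧
    (∀ mu ∈ domD g n x, IsMinOn (funG g n x fun s => eval (x s) p) (domD g n x) mu → mu = lam) ∧
    IsSOSDecomposition g n p (polyQ g n x lam) ∧
    DescentConverges g n x (fun s => eval (x s) p) lam

/-- The weights for the segment `[a, b]`: `1, (X - a)(b - X)` if `n` is even, and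
`X - a, b - X` if `n` is odd. -/
def segWeights (n : ℕ) (a b : ℝ) : Fin 2 → MvPolynomial (Fin 1) ℝ :=
  if Even n then ![1, (X 0 - C a) * (C b - X 0)] else ![X 0 - C a, C b - X 0]

end SOSDual

end

noncomputable section
namespace SOSDual
open Matrix Topology

/-! ### Trace bounds for positive semidefinite matrices. -/

section PosSemidef
variable {ι κ : Type*} [Fintype ι] [Fintype κ]

/-! The gradient of `G` has entries `p(x_s) - tr(M⁻¹ B(x_s) M⁻¹)`, and by symmetry of `M⁻¹` the
trace is the value at `x_s` of `∑_j g_j ∑_i q_ij[λ]²` (`eval_sos_polyQ`). At a critical point two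
polynomials of degree at most `n` thus agree at unisolvent points, so they are equal: critical
points are SOS decompositions.

A critical point exists by coercivity. If `p` is SOS and `V` holds the coefficients of its squares,
then up to a constant the linear part of `G^ε` is `tr(V M Vᵀ) + ε tr M`. On a sublevel set this
bounds `tr M⁻¹`, which keeps `M` away from the boundary of `D`, and `tr M`, which bounds the entries
of `M`; linear independence of the `B_s` then bounds `λ` (`isCompact_sublevel`). Uniqueness comes
from an exact second order expansion of `tr M⁻¹`, whose remainder is nonnegative and vanishes only
at equal points (`dualValue_expansion`, `eq_of_remainder_eq_zero`). The same expansion gives the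
gradient and the quadratic upper bound behind the descent argument (`descent_converges`).

On a segment, `p - ε p_B` is still positive for small `ε`. A Markov–Lukács theorem for positive
polynomials (`mem_segCone_of_pos`) makes it SOS, and the general case applied to it returns `p`
itself. Distinct nodes give unisolvence by interpolation and linear independence by a Vandermonde
argument. -/

theorem posSemidef_quadForm_nonneg {A : Matrix ι ι ℝ} (hA : A.PosSemidef) (v : ι → ℝ) :
    0 ≤ v ⬝ᵥ A *ᵥ v := by
  simpa using hA.dotProduct_mulVec_nonneg v

omit [Fintype ι] in
theorem transpose_eq_self {A : Matrix ι ι ℝ} (hA : A.IsHermitian) : Aᵀ = A :=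
  (conjTranspose_eq_transpose_of_trivial A).symm.trans hA

theorem dotProduct_mulVec_comm {A : Matrix ι ι ℝ} (hA : A.IsHermitian) (v w : ι → ℝ) :
    v ⬝ᵥ A *ᵥ w = w ⬝ᵥ A *ᵥ v := by
  rw [dotProduct_mulVec, ← mulVec_transpose, transpose_eq_self hA, dotProduct_comm]

/-- Testing the form on `e_i ± e_j` gives `2|A i j| ≤ A i i + A j j`, and each diagonal entry is at
most the trace. -/
theorem abs_apply_le_trace [DecidableEq ι] {A : Matrix ι ι ℝ} (hA : A.PosSemidef) (i j : ι) :
    |A i j| ≤ A.trace := by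
  have hd : ∀ i, 0 ≤ A i i := fun i => hA.diag_nonneg
  have hs : ∀ i j, A j i = A i j := fun i j => by simpa using hA.isHermitian.apply i j
  have hii : ∀ i, A i i ≤ A.trace := fun i =>
    Finset.single_le_sum (f := fun i => A i i) (fun i _ => hd i) (Finset.mem_univ i)
  have h1 := posSemidef_quadForm_nonneg hA (Pi.single i 1 + Pi.single j 1)
  have h2 := posSemidef_quadForm_nonneg hA (Pi.single i 1 - Pi.single j 1)
  simp only [mulVec_add, mulVec_sub, add_dotProduct, sub_dotProduct, dotProduct_add,
    dotProduct_sub, mulVec_single, single_dotProduct, one_mul, MulOpposite.op_one, one_smul,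
    col_apply, hs i j] at h1 h2
  rw [abs_le]
  constructor <;> linarith [hii i, hii j]

theorem quadForm_le_trace [DecidableEq ι] {A : Matrix ι ι ℝ} (hA : A.PosSemidef) (v : ι → ℝ) :
    v ⬝ᵥ A *ᵥ v ≤ Fintype.card ι * A.trace * (v ⬝ᵥ v) := by
  have hterm : ∀ i j, v i * (A i j * v j) ≤ A.trace * ((v i * v i + v j * v j) / 2) := fun i j => by
    have h1 : v i * (A i j * v j) ≤ |A i j| * |v i * v j| := by
      rw [← abs_mul]; exact (le_of_eq (by ring)).trans (le_abs_self _)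
    have h2 : |v i * v j| ≤ (v i * v i + v j * v j) / 2 := by
      rw [abs_le]; constructor <;> nlinarith [sq_nonneg (v i + v j), sq_nonneg (v i - v j)]
    exact h1.trans (mul_le_mul (abs_apply_le_trace hA i j) h2 (abs_nonneg _) hA.trace_nonneg)
  calc v ⬝ᵥ A *ᵥ v = ∑ i, ∑ j, v i * (A i j * v j) := by
        simp [dotProduct, mulVec, Finset.mul_sum]
    _ ≤ ∑ i, ∑ j, A.trace * ((v i * v i + v j * v j) / 2) :=
        Finset.sum_le_sum fun i _ => Finset.sum_le_sum fun j _ => hterm i j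
    _ = Fintype.card ι * A.trace * (v ⬝ᵥ v) := by
        simp_rw [← Finset.mul_sum, ← Finset.sum_div, Finset.sum_add_distrib]
        simp only [Finset.sum_const, Finset.card_univ, nsmul_eq_mul, ← Finset.mul_sum, dotProduct]
        ring

theorem posDef_of_le_quadForm {A : Matrix ι ι ℝ} (hA : A.IsHermitian) {c : ℝ} (hc : 0 < c)
    (h : ∀ v, c * (v ⬝ᵥ v) ≤ v ⬝ᵥ A *ᵥ v) : A.PosDef := by
  refine .of_dotProduct_mulVec_pos hA fun v hv => ?_
  have : 0 < v ⬝ᵥ v := by simpa using dotProduct_star_self_pos_iff.2 hv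
  simpa using (mul_pos hc this).trans_le (h v)

/-- A bound on `tr M⁻¹` bounds `M⁻¹` from above, hence `M` from below, uniformly. The inversion
needs no eigenvalues: expand the form of `M` at `v - K⁻¹ M⁻¹ v`. The `+ 1` keeps `K` positive even
for `C = 0` or an empty index type. -/
theorem quadForm_ge_of_trace_inv_le [DecidableEq ι] {M : Matrix ι ι ℝ} (hM : M.PosDef) {C : ℝ}
    (hC : M⁻¹.trace ≤ C) (v : ι → ℝ) :
    (Fintype.card ι * C + 1)⁻¹ * (v ⬝ᵥ v) ≤ v ⬝ᵥ M *ᵥ v := by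
  have hC0 : 0 ≤ C := hM.inv.posSemidef.trace_nonneg.trans hC
  set K : ℝ := Fintype.card ι * C + 1 with hK
  have hKpos : 0 < K := by positivity
  have hv : 0 ≤ v ⬝ᵥ v := by simpa using dotProduct_star_self_nonneg v
  have h1 : v ⬝ᵥ M⁻¹ *ᵥ v ≤ K * (v ⬝ᵥ v) := by
    refine (quadForm_le_trace hM.inv.posSemidef v).trans (mul_le_mul_of_nonneg_right ?_ hv)
    have := mul_le_mul_of_nonneg_left hC (Nat.cast_nonneg (α := ℝ) (Fintype.card ι))
    linarith
  have hMi : M *ᵥ (M⁻¹ *ᵥ v) = v := by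
    rw [mulVec_mulVec, mul_nonsing_inv _ ((isUnit_iff_isUnit_det _).1 hM.isUnit), one_mulVec]
  have h2 := posSemidef_quadForm_nonneg hM.posSemidef (v - K⁻¹ • (M⁻¹ *ᵥ v))
  have h3 : (M⁻¹ *ᵥ v) ⬝ᵥ M *ᵥ v = v ⬝ᵥ v := by
    rw [dotProduct_mulVec_comm hM.isHermitian, hMi]
  simp only [mulVec_sub, mulVec_smul, hMi, sub_dotProduct, dotProduct_sub, smul_dotProduct,
    dotProduct_smul, smul_eq_mul, h3, dotProduct_comm (M⁻¹ *ᵥ v) v] at h2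
  have h4 : K⁻¹ * (K⁻¹ * (v ⬝ᵥ M⁻¹ *ᵥ v)) ≤ K⁻¹ * (v ⬝ᵥ v) := by
    refine mul_le_mul_of_nonneg_left ?_ (by positivity)
    rw [inv_mul_le_iff₀ hKpos]; exact h1
  linarith

theorem trace_conj_nonneg {A : Matrix ι ι ℝ} (hA : A.PosSemidef) (V : Matrix κ ι ℝ) :
    0 ≤ (V * A * Vᵀ).trace := by
  simpa using (hA.mul_mul_conjTranspose_same V).trace_nonneg

theorem trace_conj_eq_sum (A : Matrix ι ι ℝ) (V : Matrix κ ι ℝ) :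
    (V * A * Vᵀ).trace = ∑ i, V i ⬝ᵥ A *ᵥ V i := by
  simp [trace, Matrix.mul_assoc, mul_apply, dotProduct, mulVec]

end PosSemidef

/-! ### The dual function of an affine matrix pencil: expansion, gradient, compact sublevel sets. -/

section Pencil
variable {ι κ : Type*} [Fintype ι] [DecidableEq ι] [Fintype κ] {r : ℕ}
  (B : Fin r → Matrix ι ι ℝ) (y : Fin r → ℝ)

/-- The affine matrix pencil `I + ∑_s λ_s B_s`. -/
def pencil (lam : Fin r → ℝ) : Matrix ι ι ℝ := 1 + ∑ s, lam s • B s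

/-- The domain of positive definiteness of the pencil. -/
def pencilDom : Set (Fin r → ℝ) := {lam | (pencil B lam).PosDef}

/-- The function `tr M(λ)⁻¹ + ∑_s y_s λ_s`. -/
def dualValue (lam : Fin r → ℝ) : ℝ := (pencil B lam)⁻¹.trace + ∑ s, y s * lam s

/-- The formula for the gradient of `dualValue`. -/
def dualGrad (lam : Fin r → ℝ) : Fin r → ℝ :=
  fun s => y s - ((pencil B lam)⁻¹ * B s * (pencil B lam)⁻¹).trace

omit [Fintype ι] in
theorem pencil_zero : pencil B 0 = 1 := by simp [pencil]

omit [Fintype ι] in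
theorem zero_mem_pencilDom : (0 : Fin r → ℝ) ∈ pencilDom B := by
  simpa [pencilDom, pencil_zero] using Matrix.PosDef.one

omit [Fintype ι] in
theorem pencil_sub (lam mu : Fin r → ℝ) :
    pencil B mu - pencil B lam = ∑ s, (mu - lam) s • B s := by
  simp [pencil, sub_smul, Finset.sum_sub_distrib]

omit [Fintype ι] in
theorem continuous_pencil : Continuous (pencil B) := by
  unfold pencil; fun_prop

omit [Fintype ι] in
variable {B} in
theorem pencil_isHermitian (hB : ∀ s, (B s).IsHermitian) (lam : Fin r → ℝ) :
    (pencil B lam).IsHermitian := by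
  have h : ∀ s, (B s)ᵀ = B s := fun s => transpose_eq_self (hB s)
  simp [Matrix.IsHermitian, pencil, transpose_sum, h]

theorem continuousOn_pencil_inv : ContinuousOn (fun lam => (pencil B lam)⁻¹) (pencilDom B) := by
  intro lam hlam
  have hdet : (pencil B lam).det ≠ 0 := ((isUnit_iff_isUnit_det _).1 hlam.isUnit).ne_zero
  have : ContinuousAt Ring.inverse (pencil B lam).det := by
    rw [Ring.inverse_eq_inv']; exact continuousAt_inv₀ hdet
  exact (ContinuousAt.comp (f := pencil B) (continuousAt_matrix_inv _ this)
    (continuous_pencil B).continuousAt).continuousWithinAt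

variable {B} in
-- Positivity of the form need only be tested on the unit sphere, whose compactness makes it persist
-- for nearby parameters.
theorem isOpen_pencilDom (hB : ∀ s, (B s).IsHermitian) : IsOpen (pencilDom B) := by
  rw [isOpen_iff_mem_nhds]
  intro lam hlam
  have hcpt : IsCompact {v : ι → ℝ | v ⬝ᵥ v = 1} := by
    refine Metric.isCompact_of_isClosed_isBounded (isClosed_eq (by fun_prop) continuous_const)
      ((Metric.isBounded_closedBall (x := 0) (r := 1)).subset fun v hv => ?_)
    rw [mem_closedBall_zero_iff, pi_norm_le_iff_of_nonneg zero_le_one]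
    intro i
    have h1 : v i * v i ≤ v ⬝ᵥ v :=
      Finset.single_le_sum (f := fun i => v i * v i) (fun i _ => mul_self_nonneg _)
        (Finset.mem_univ i)
    rw [Set.mem_ofPred_eq] at hv
    rw [Real.norm_eq_abs, abs_le]
    constructor <;> nlinarith
  have hev := hcpt.eventually_forall_of_forall_eventually (x₀ := lam)
    (P := fun mu v => 0 < v ⬝ᵥ pencil B mu *ᵥ v) (fun v hv => by
      have hc : Continuous fun z : (Fin r → ℝ) × (ι → ℝ) => z.2 ⬝ᵥ pencil B z.1 *ᵥ z.2 :=
        continuous_snd.dotProduct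
          (((continuous_pencil B).comp continuous_fst).matrix_mulVec continuous_snd)
      refine (hc.tendsto (lam, v)).eventually (lt_mem_nhds ?_)
      have hv0 : v ≠ 0 := by rintro rfl; simp at hv
      simpa using hlam.dotProduct_mulVec_pos hv0)
  filter_upwards [hev] with mu hmu
  refine .of_dotProduct_mulVec_pos (pencil_isHermitian hB mu) fun v hv => ?_
  have hpos : 0 < v ⬝ᵥ v := by simpa using dotProduct_star_self_pos_iff.2 hv
  have hs := Real.sqrt_pos.2 hpos
  have h := hmu ((√(v ⬝ᵥ v))⁻¹ • v) (by
    simp only [smul_dotProduct, dotProduct_smul, smul_eq_mul]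
    rw [← mul_assoc, ← mul_inv, Real.mul_self_sqrt hpos.le, inv_mul_cancel₀ hpos.ne'])
  simp only [mulVec_smul, smul_dotProduct, dotProduct_smul, smul_eq_mul] at h
  have h' := pos_of_mul_pos_right (pos_of_mul_pos_right h (inv_pos.2 hs).le) (inv_pos.2 hs).le
  simpa using h'

/-- The resolvent identity, used twice. Being exact, it replaces any calculus of second derivatives.
-/
theorem inv_expansion {M N : Matrix ι ι ℝ} (hM : IsUnit M) (hN : IsUnit N) :
    N⁻¹ = M⁻¹ - M⁻¹ * (N - M) * M⁻¹ + M⁻¹ * (N - M) * N⁻¹ * (N - M) * M⁻¹ := by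
  rw [isUnit_iff_isUnit_det] at hM hN
  have e1 : M⁻¹ * (N - M) * N⁻¹ = M⁻¹ - N⁻¹ := by
    rw [Matrix.mul_sub, Matrix.sub_mul, nonsing_inv_mul _ hM, Matrix.one_mul, Matrix.mul_assoc,
      mul_nonsing_inv _ hN, Matrix.mul_one]
  have e2 : N⁻¹ * (N - M) * M⁻¹ = M⁻¹ - N⁻¹ := by
    rw [Matrix.mul_sub, Matrix.sub_mul, nonsing_inv_mul _ hN, Matrix.one_mul, Matrix.mul_assoc,
      mul_nonsing_inv _ hM, Matrix.mul_one]
  rw [e1, Matrix.sub_mul, Matrix.sub_mul, e2]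
  abel

theorem dualValue_expansion {lam mu : Fin r → ℝ} (hlam : lam ∈ pencilDom B)
    (hmu : mu ∈ pencilDom B) :
    dualValue B y mu = dualValue B y lam + dualGrad B y lam ⬝ᵥ (mu - lam) +
      ((pencil B lam)⁻¹ * (pencil B mu - pencil B lam) * (pencil B mu)⁻¹ *
        (pencil B mu - pencil B lam) * (pencil B lam)⁻¹).trace := by
  have h := congrArg trace (inv_expansion hlam.isUnit hmu.isUnit)
  rw [trace_add, trace_sub] at h
  have h2 : ((pencil B lam)⁻¹ * (pencil B mu - pencil B lam) * (pencil B lam)⁻¹).trace =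
      ∑ s, (mu - lam) s * ((pencil B lam)⁻¹ * B s * (pencil B lam)⁻¹).trace := by
    simp only [pencil_sub, Finset.mul_sum, Finset.sum_mul, trace_sum, Matrix.mul_smul,
      Matrix.smul_mul, trace_smul, smul_eq_mul]
  have h3 : dualGrad B y lam ⬝ᵥ (mu - lam) = ∑ s, y s * mu s - ∑ s, y s * lam s -
      ∑ s, (mu - lam) s * ((pencil B lam)⁻¹ * B s * (pencil B lam)⁻¹).trace := by
    simp only [dotProduct, dualGrad, ← Finset.sum_sub_distrib]
    exact Finset.sum_congr rfl fun s _ => by simp only [Pi.sub_apply]; ring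
  rw [dualValue, dualValue, h3, h, h2]
  ring

variable {B} in
theorem pencil_inv_transpose (hB : ∀ s, (B s).IsHermitian) (lam : Fin r → ℝ) :
    ((pencil B lam)⁻¹)ᵀ = (pencil B lam)⁻¹ :=
  transpose_eq_self (pencil_isHermitian hB lam).inv

variable {B} in
theorem remainder_nonneg (hB : ∀ s, (B s).IsHermitian) {lam mu : Fin r → ℝ}
    (hmu : mu ∈ pencilDom B) :
    0 ≤ ((pencil B lam)⁻¹ * (pencil B mu - pencil B lam) * (pencil B mu)⁻¹ *
        (pencil B mu - pencil B lam) * (pencil B lam)⁻¹).trace := by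
  have ht : ((pencil B lam)⁻¹ * (pencil B mu - pencil B lam))ᵀ =
      (pencil B mu - pencil B lam) * (pencil B lam)⁻¹ := by
    rw [transpose_mul, pencil_inv_transpose hB, transpose_sub,
      transpose_eq_self (pencil_isHermitian hB _), transpose_eq_self (pencil_isHermitian hB _)]
  have := trace_conj_nonneg hmu.inv.posSemidef
    ((pencil B lam)⁻¹ * (pencil B mu - pencil B lam))
  rwa [ht, ← Matrix.mul_assoc] at this

variable {B} in
-- The remainder is `tr(W N⁻¹ Wᵀ)` with `N⁻¹` positive definite and `W = M⁻¹(N - M)`. If it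
-- vanishes, every row of `W` is zero, so `N = M`, and linear independence identifies the
-- parameters.
theorem eq_of_remainder_eq_zero (hB : ∀ s, (B s).IsHermitian) (hli : LinearIndependent ℝ B)
    {lam mu : Fin r → ℝ} (hlam : lam ∈ pencilDom B) (hmu : mu ∈ pencilDom B)
    (h : ((pencil B lam)⁻¹ * (pencil B mu - pencil B lam) * (pencil B mu)⁻¹ *
        (pencil B mu - pencil B lam) * (pencil B lam)⁻¹).trace = 0) : mu = lam := by
  set P := (pencil B lam)⁻¹
  set Δ := pencil B mu - pencil B lam with hΔ
  have hPt : Pᵀ = P := pencil_inv_transpose hB lam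
  have hΔt : Δᵀ = Δ := by
    rw [hΔ, transpose_sub, transpose_eq_self (pencil_isHermitian hB _),
      transpose_eq_self (pencil_isHermitian hB _)]
  have hPu : IsUnit P := hlam.inv.isUnit
  have hN : ((pencil B mu)⁻¹).PosDef := hmu.inv
  have hfac : P * Δ * (pencil B mu)⁻¹ * Δ * P =
      (P * Δ) * (pencil B mu)⁻¹ * (P * Δ)ᴴ := by
    rw [conjTranspose_eq_transpose_of_trivial, transpose_mul, hPt, hΔt, ← Matrix.mul_assoc]
  have hz : P * Δ = 0 := by
    have hpsd := hN.posSemidef.mul_mul_conjTranspose_same (P * Δ)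
    rw [← hfac] at hpsd
    have h0 := hpsd.trace_eq_zero_iff.1 h
    rw [hfac] at h0
    ext i j
    by_contra hne
    have hrow : (P * Δ) i ≠ 0 := fun h => hne (by rw [h]; rfl)
    have hpos := hN.dotProduct_mulVec_pos hrow
    have h00 := congrFun (congrFun h0 i) i
    rw [star_trivial] at hpos
    have : ((P * Δ) * (pencil B mu)⁻¹ * (P * Δ)ᴴ) i i =
        (P * Δ) i ⬝ᵥ (pencil B mu)⁻¹ *ᵥ (P * Δ) i := by
      rw [Matrix.mul_assoc, mul_apply]
      rfl
    rw [← this, h00] at hpos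
    exact lt_irrefl _ hpos
  have hΔ0 : Δ = 0 := by
    have := congrArg (P⁻¹ * ·) hz
    simpa [← Matrix.mul_assoc, nonsing_inv_mul _ ((isUnit_iff_isUnit_det _).1 hPu)] using this
  rw [hΔ, pencil_sub] at hΔ0
  have := Fintype.linearIndependent_iff.1 hli _ hΔ0
  funext s
  simpa [sub_eq_zero] using this s

variable {B} in
theorem dualValue_le_of_dualGrad_eq_zero (hB : ∀ s, (B s).IsHermitian) {lam mu : Fin r → ℝ}
    (hlam : lam ∈ pencilDom B) (hmu : mu ∈ pencilDom B) (h : dualGrad B y lam = 0) :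
    dualValue B y lam ≤ dualValue B y mu := by
  have := dualValue_expansion B y hlam hmu
  have h2 := remainder_nonneg hB (lam := lam) hmu
  rw [h, zero_dotProduct] at this
  linarith

variable {B} in
theorem eq_of_dualGrad_eq_zero (hB : ∀ s, (B s).IsHermitian) (hli : LinearIndependent ℝ B)
    {lam mu : Fin r → ℝ} (hlam : lam ∈ pencilDom B) (hmu : mu ∈ pencilDom B)
    (h : dualGrad B y lam = 0) (hle : dualValue B y mu ≤ dualValue B y lam) : mu = lam := by
  refine eq_of_remainder_eq_zero hB hli hlam hmu (le_antisymm ?_ (remainder_nonneg hB hmu))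
  have := dualValue_expansion B y hlam hmu
  rw [h, zero_dotProduct] at this
  linarith

/-- The remainder is quadratic in `mu - lam` with coefficients continuous on `K × K`. As the
expansion is exact, the segment between the points plays no role and `K` need not be convex. -/
theorem exists_remainder_bound {K : Set (Fin r → ℝ)} (hK : IsCompact K) (hKD : K ⊆ pencilDom B) :
    ∃ L : ℝ, 0 < L ∧ ∀ lam ∈ K, ∀ mu ∈ K,
      |((pencil B lam)⁻¹ * (pencil B mu - pencil B lam) * (pencil B mu)⁻¹ *
        (pencil B mu - pencil B lam) * (pencil B lam)⁻¹).trace| ≤ L * ‖mu - lam‖ ^ 2 := by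
  have hc : ∀ s t, ContinuousOn (fun z : (Fin r → ℝ) × (Fin r → ℝ) =>
      ((pencil B z.1)⁻¹ * B s * (pencil B z.2)⁻¹ * B t * (pencil B z.1)⁻¹).trace) (K ×ˢ K) := by
    intro s t
    rw [continuousOn_iff_continuous_domRestrict]
    have hi := continuousOn_iff_continuous_domRestrict.1 ((continuousOn_pencil_inv B).mono hKD)
    have h1 : Continuous fun z : (K ×ˢ K : Set _) => (pencil B z.1.1)⁻¹ :=
      hi.comp (f := fun z : (K ×ˢ K : Set ((Fin r → ℝ) × (Fin r → ℝ))) => (⟨z.1.1, z.2.1⟩ : K))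
        (by fun_prop)
    have h2 : Continuous fun z : (K ×ˢ K : Set _) => (pencil B z.1.2)⁻¹ :=
      hi.comp (f := fun z : (K ×ˢ K : Set ((Fin r → ℝ) × (Fin r → ℝ))) => (⟨z.1.2, z.2.2⟩ : K))
        (by fun_prop)
    exact ((((h1.mul continuous_const).mul h2).mul continuous_const).mul h1).matrix_trace
  choose C hC using fun s t => (hK.prod hK).exists_bound_of_continuousOn (hc s t)
  refine ⟨∑ s, ∑ t, |C s t| + 1, by positivity, fun lam hlam mu hmu => ?_⟩
  have hexp : ((pencil B lam)⁻¹ * (pencil B mu - pencil B lam) * (pencil B mu)⁻¹ *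
        (pencil B mu - pencil B lam) * (pencil B lam)⁻¹).trace =
      ∑ s, ∑ t, (mu - lam) s * (mu - lam) t *
        ((pencil B lam)⁻¹ * B s * (pencil B mu)⁻¹ * B t * (pencil B lam)⁻¹).trace := by
    simp only [pencil_sub, Finset.mul_sum, Finset.sum_mul, trace_sum, Matrix.mul_smul,
      Matrix.smul_mul, trace_smul, smul_eq_mul]
    rw [Finset.sum_comm]
    exact Finset.sum_congr rfl fun s _ => Finset.sum_congr rfl fun t _ => by ring
  rw [hexp]
  calc _ ≤ ∑ s, ∑ t, |C s t| * ‖mu - lam‖ ^ 2 := by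
        refine (Finset.abs_sum_le_sum_abs _ _).trans (Finset.sum_le_sum fun s _ =>
          (Finset.abs_sum_le_sum_abs _ _).trans (Finset.sum_le_sum fun t _ => ?_))
        rw [abs_mul, abs_mul, mul_comm]
        refine mul_le_mul ((hC s t (lam, mu) ⟨hlam, hmu⟩).trans (le_abs_self _)) ?_
          (by positivity) (abs_nonneg _)
        rw [sq]
        exact mul_le_mul (norm_le_pi_norm (mu - lam) s) (norm_le_pi_norm (mu - lam) t) (abs_nonneg _) (norm_nonneg _)
    _ = (∑ s, ∑ t, |C s t|) * ‖mu - lam‖ ^ 2 := by simp only [Finset.sum_mul]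
    _ ≤ _ := mul_le_mul_of_nonneg_right (by linarith) (by positivity)

variable {B} in
theorem hasFDerivAt_dualValue (hB : ∀ s, (B s).IsHermitian) {lam : Fin r → ℝ}
    (hlam : lam ∈ pencilDom B) :
    HasFDerivAt (dualValue B y)
      (∑ s, dualGrad B y lam s • ContinuousLinearMap.proj (R := ℝ) (φ := fun _ : Fin r => ℝ) s)
      lam := by
  obtain ⟨δ, hδ, hball⟩ := Metric.nhds_basis_closedBall.mem_iff.1
    ((isOpen_pencilDom hB).mem_nhds hlam)
  obtain ⟨L, -, hL⟩ := exists_remainder_bound B (isCompact_closedBall lam δ) hball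
  set T := ∑ s, dualGrad B y lam s • ContinuousLinearMap.proj (R := ℝ) (φ := fun _ : Fin r => ℝ) s
  have hT : ∀ v, T v = dualGrad B y lam ⬝ᵥ v := fun v => by simp [T, dotProduct]
  have h0 : HasFDerivAt (fun mu => dualValue B y mu - T (mu - lam) - dualValue B y lam)
      (0 : (Fin r → ℝ) →L[ℝ] ℝ) lam := by
    refine Asymptotics.IsBigO.hasFDerivAt (n := 2) ?_ one_lt_two
    refine Asymptotics.IsBigO.of_bound L ?_
    filter_upwards [Metric.closedBall_mem_nhds lam hδ] with mu hmu
    have := hL lam (Metric.mem_closedBall_self hδ.le) mu hmu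
    rw [Real.norm_eq_abs, norm_pow, norm_norm]
    convert this using 2
    rw [dualValue_expansion B y hlam (hball hmu), hT]
    ring
  have h1 : HasFDerivAt (fun mu => T (mu - lam)) T lam :=
    T.hasFDerivAt.comp lam ((hasFDerivAt_id lam).sub_const lam)
  have h2 := (h0.add h1).add_const (dualValue B y lam)
  rw [zero_add] at h2
  refine h2.congr_of_eventuallyEq (.of_forall fun mu => ?_)
  simp only [Pi.add_apply]
  ring

theorem continuousOn_dualValue : ContinuousOn (dualValue B y) (pencilDom B) := by
  unfold dualValue
  refine ContinuousOn.add ?_ (by fun_prop)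
  exact (continuous_id.matrix_trace).comp_continuousOn (continuousOn_pencil_inv B)

theorem continuousOn_dualGrad : ContinuousOn (dualGrad B y) (pencilDom B) := by
  unfold dualGrad
  refine continuousOn_pi.2 fun s => continuousOn_const.sub ?_
  have h := continuousOn_pencil_inv B
  rw [continuousOn_iff_continuous_domRestrict] at h ⊢
  exact ((h.mul continuous_const).mul h).matrix_trace

variable {B y} in
theorem isCompact_sublevel (hB : ∀ s, (B s).IsHermitian) (hli : LinearIndependent ℝ B)
    {V : Matrix κ ι ℝ} {ε : ℝ} (hε : 0 < ε)
    (hy : ∀ s, y s = (V * B s * Vᵀ).trace + ε * (B s).trace) (c : ℝ) :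
    IsCompact {lam | lam ∈ pencilDom B ∧ dualValue B y lam ≤ c} := by
  set K := {lam | lam ∈ pencilDom B ∧ dualValue B y lam ≤ c}
  set c₀ := (V * (1 : Matrix ι ι ℝ) * Vᵀ).trace + ε * (1 : Matrix ι ι ℝ).trace
  have hlin : ∀ lam, ∑ s, y s * lam s =
      (V * pencil B lam * Vᵀ).trace + ε * (pencil B lam).trace - c₀ := fun lam => by
    have h1 : ∑ s, y s * lam s =
        (V * (∑ s, lam s • B s) * Vᵀ).trace + ε * (∑ s, lam s • B s).trace := by
      simp only [Matrix.mul_sum, Matrix.sum_mul, Matrix.mul_smul, Matrix.smul_mul, trace_sum,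
        trace_smul, smul_eq_mul, hy, Finset.mul_sum, ← Finset.sum_add_distrib]
      exact Finset.sum_congr rfl fun s _ => by ring
    rw [h1, pencil, Matrix.mul_add, Matrix.add_mul, trace_add, trace_add]
    ring
  have hbd : ∀ lam ∈ K, (pencil B lam)⁻¹.trace ≤ c + c₀ ∧ (pencil B lam).trace ≤ (c + c₀) / ε := by
    rintro lam ⟨hD, hle⟩
    have h1 := trace_conj_nonneg hD.posSemidef V
    have h2 := hD.posSemidef.trace_nonneg
    have h3 := hD.inv.posSemidef.trace_nonneg
    rw [dualValue, hlin] at hle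
    have h4 : 0 ≤ ε * (pencil B lam).trace := by positivity
    refine ⟨by linarith, ?_⟩
    rw [le_div_iff₀ hε]
    linarith
  by_cases hne : K = ∅
  · rw [hne]; exact isCompact_empty
  obtain ⟨lam₀, hlam₀⟩ := Set.nonempty_iff_ne_empty.2 hne
  have hC : 0 ≤ c + c₀ := hlam₀.1.inv.posSemidef.trace_nonneg.trans (hbd _ hlam₀).1
  set η : ℝ := (Fintype.card ι * (c + c₀) + 1)⁻¹
  have hη : 0 < η := by positivity
  set T := (c + c₀) / ε
  -- The domain is open, so closedness is obtained by enclosing `K` in a closed set with a uniform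
  -- lower bound `η` on the pencil.
  set K' := {lam | (∀ v, η * (v ⬝ᵥ v) ≤ v ⬝ᵥ pencil B lam *ᵥ v) ∧ ∀ i j, |pencil B lam i j| ≤ T}
  have hKK' : K ⊆ K' := fun lam h =>
    ⟨quadForm_ge_of_trace_inv_le h.1 (hbd _ h).1,
      fun i j => (abs_apply_le_trace h.1.posSemidef i j).trans (hbd _ h).2⟩
  have hK'D : K' ⊆ pencilDom B := fun lam h =>
    posDef_of_le_quadForm (pencil_isHermitian hB lam) hη h.1
  have hK'cl : IsClosed K' := by
    refine IsClosed.and ?_ ?_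
    · simp only [Set.ofPred_forall]
      exact isClosed_iInter fun v => isClosed_le continuous_const
        (continuous_const.dotProduct ((continuous_pencil B).matrix_mulVec continuous_const))
    · simp only [Set.ofPred_forall]
      exact isClosed_iInter fun i => isClosed_iInter fun j => isClosed_le
        ((continuous_pencil B).matrix_elem i j).abs continuous_const
  have hK'cpt : IsCompact K' := by
    set Φ : (Fin r → ℝ) →ₗ[ℝ] Matrix ι ι ℝ := Fintype.linearCombination ℝ B
    have hΦ : LinearMap.ker Φ = ⊥ := 
      LinearMap.ker_eq_bot.2 (linearIndependent_iff_injective_fintypeLinearCombination.1 hli)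
    -- A linear left inverse recovers `λ` from `M(λ) - I`, so bounded entries of `M(λ)` confine `λ`
    -- to a compact set.
    obtain ⟨Ψ, hΨ⟩ := Φ.exists_leftInverse_of_injective hΦ
    have hΨc : Continuous Ψ := Ψ.continuous_of_finiteDimensional
    have hbox : IsCompact {A : Matrix ι ι ℝ | ∀ i j, A i j ∈ Set.Icc (-T) T} := by
      have := isCompact_univ_pi fun _ : ι => isCompact_univ_pi fun _ : ι =>
        isCompact_Icc (a := -T) (b := T)
      have hset : {A : Matrix ι ι ℝ | ∀ i j, A i j ∈ Set.Icc (-T) T} =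
          Set.univ.pi fun _ => Set.univ.pi fun _ => Set.Icc (-T) T :=
        Set.ext fun A => ⟨fun h i _ j _ => h i j, fun h i j => h i trivial j trivial⟩
      rw [hset]
      exact this
    refine (hbox.image (f := fun A => Ψ (A - 1)) (hΨc.comp (continuous_id.sub continuous_const))
      ).of_isClosed_subset hK'cl fun lam h => ⟨pencil B lam, fun i j => abs_le.1 (h.2 i j), ?_⟩
    have : pencil B lam - 1 = Φ lam := by
      simp [pencil, Φ, Fintype.linearCombination_apply]
    simp only [this]
    exact LinearMap.congr_fun hΨ lam
  have : K = K' ∩ dualValue B y ⁻¹' Set.Iic c :=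
    Set.Subset.antisymm (fun lam h => ⟨hKK' h, h.2⟩) fun lam h => ⟨hK'D h.1, h.2⟩
  rw [this]
  exact hK'cpt.of_isClosed_subset
    (((continuousOn_dualValue B y).mono hK'D).preimage_isClosed_of_isClosed hK'cl isClosed_Iic)
    Set.inter_subset_left

end Pencil

/-! ### Preconditioned gradient descent with compact sublevel sets. -/

section Descent
variable {r : ℕ}

theorem sq_norm_le_dotProduct_self (v : Fin r → ℝ) : ‖v‖ ^ 2 ≤ v ⬝ᵥ v := by
  have h0 : 0 ≤ v ⬝ᵥ v := by simpa using dotProduct_star_self_nonneg v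
  have : ‖v‖ ≤ √(v ⬝ᵥ v) := by
    refine (pi_norm_le_iff_of_nonneg (Real.sqrt_nonneg _)).2 fun i => ?_
    rw [Real.norm_eq_abs]
    refine Real.abs_le_sqrt ?_
    rw [sq]
    exact Finset.single_le_sum (f := fun i => v i * v i) (fun i _ => mul_self_nonneg _)
      (Finset.mem_univ i)
  calc ‖v‖ ^ 2 ≤ √(v ⬝ᵥ v) ^ 2 := by gcongr
    _ = v ⬝ᵥ v := Real.sq_sqrt h0

/-- With `v = H⁻¹ g`, the bounds come from the forms of `H - a` at `v` and of `H` at `v - b⁻¹ g`,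
and from `|g - a v|² ≥ 0`. -/
theorem preconditioned_step_bounds {a b : ℝ} (ha : 0 < a) (hab : a ≤ b)
    {H : Matrix (Fin r) (Fin r) ℝ} (h1 : (H - a • (1 : Matrix (Fin r) (Fin r) ℝ)).PosSemidef)
    (h2 : (b • (1 : Matrix (Fin r) (Fin r) ℝ) - H).PosSemidef) (g : Fin r → ℝ) :
    a * (H⁻¹ *ᵥ g ⬝ᵥ H⁻¹ *ᵥ g) ≤ g ⬝ᵥ H⁻¹ *ᵥ g ∧ g ⬝ᵥ g ≤ b * (g ⬝ᵥ H⁻¹ *ᵥ g) ∧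
      a ^ 2 * (H⁻¹ *ᵥ g ⬝ᵥ H⁻¹ *ᵥ g) ≤ g ⬝ᵥ g := by
  have hb : 0 < b := ha.trans_le hab
  have hH : H.PosDef := by
    have := PosDef.posSemidef_add h1 (PosDef.one.smul ha)
    rwa [sub_add_cancel] at this
  have hHg : H *ᵥ (H⁻¹ *ᵥ g) = g := by
    rw [mulVec_mulVec, mul_nonsing_inv _ ((isUnit_iff_isUnit_det _).1 hH.isUnit), one_mulVec]
  have hsym := dotProduct_mulVec_comm hH.isHermitian
  set v := H⁻¹ *ᵥ g
  have e1 := posSemidef_quadForm_nonneg h1 v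
  have e2 := posSemidef_quadForm_nonneg h2 g
  have e3 := posSemidef_quadForm_nonneg hH.posSemidef (v - b⁻¹ • g)
  have e4 : 0 ≤ (g - a • v) ⬝ᵥ (g - a • v) := by
    simpa using dotProduct_star_self_nonneg (g - a • v)
  have e5 := hsym v g
  simp only [sub_mulVec, mulVec_sub, mulVec_smul, smul_mulVec, one_mulVec, dotProduct_sub,
    sub_dotProduct, dotProduct_smul, smul_dotProduct, smul_eq_mul, hHg, dotProduct_comm v g]
    at e1 e2 e3 e4 e5
  rw [e5] at e3
  refine ⟨by linarith, ?_, by nlinarith⟩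
  have e6 : b⁻¹ * (b⁻¹ * (g ⬝ᵥ H *ᵥ g)) ≤ b⁻¹ * (g ⬝ᵥ g) := by
    refine mul_le_mul_of_nonneg_left ?_ (by positivity)
    rw [inv_mul_le_iff₀ hb]; linarith
  have e7 : b⁻¹ * (g ⬝ᵥ g) ≤ g ⬝ᵥ v := by linarith
  rwa [inv_mul_le_iff₀ hb] at e7

/-- Each step stays in the sublevel set and lowers `f` by a fixed multiple of `|grad|²`. Since `f`
is bounded below there, gradients tend to zero, so every cluster point is critical, hence equal to
`xs`; compactness gives convergence. -/
theorem descent_converges {f : (Fin r → ℝ) → ℝ} {grad : (Fin r → ℝ) → Fin r → ℝ}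
    {D : Set (Fin r → ℝ)} (hD : IsOpen D) (hf : ContinuousOn f D) (hgrad : ContinuousOn grad D)
    {x₀ xs : Fin r → ℝ} (hx₀ : x₀ ∈ D) (hK : IsCompact {x | x ∈ D ∧ f x ≤ f x₀})
    (hquad : ∀ C ⊆ D, IsCompact C → ∃ L : ℝ, 0 < L ∧ ∀ x ∈ C, ∀ z ∈ C,
      f z ≤ f x + grad x ⬝ᵥ (z - x) + L * ‖z - x‖ ^ 2)
    (huniq : ∀ x ∈ D, f x ≤ f x₀ → grad x = 0 → x = xs) {a b : ℝ} (ha : 0 < a) (hab : a ≤ b) :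
    ∃ τmax : ℝ, 0 < τmax ∧
    ∀ (τmin : ℝ) (τ : ℕ → ℝ) (H : ℕ → Matrix (Fin r) (Fin r) ℝ) (lam : ℕ → Fin r → ℝ),
      0 < τmin → (∀ m, τmin ≤ τ m ∧ τ m ≤ τmax) →
      (∀ m, (H m - a • (1 : Matrix (Fin r) (Fin r) ℝ)).PosSemidef ∧
        (b • (1 : Matrix (Fin r) (Fin r) ℝ) - H m).PosSemidef) →
      lam 0 = x₀ →
      (∀ m, lam m ∈ D → lam (m + 1) = lam m - τ m • ((H m)⁻¹).mulVec (grad (lam m))) →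
      (∀ m, lam m ∈ D) ∧ Filter.Tendsto lam Filter.atTop (𝓝 xs) := by
  set K := {x | x ∈ D ∧ f x ≤ f x₀}
  have hKD : K ⊆ D := fun x h => h.1
  obtain ⟨δ, hδ, hCD⟩ := hK.exists_cthickening_subset_open hD hKD
  obtain ⟨L, hL0, hL⟩ := hquad _ hCD hK.cthickening
  have hgg : ContinuousOn (fun x => grad x ⬝ᵥ grad x) D := by
    have := continuousOn_iff_continuous_domRestrict.1 hgrad
    exact continuousOn_iff_continuous_domRestrict.2 (this.dotProduct this)
  obtain ⟨G₀, hG₀⟩ := hK.exists_bound_of_continuousOn (hgg.mono hKD)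
  set G := |G₀|
  have hG : ∀ x ∈ K, grad x ⬝ᵥ grad x ≤ G := fun x hx =>
    (le_abs_self _).trans ((hG₀ x hx).trans (le_abs_self _))
  have hGnn : 0 ≤ G := abs_nonneg _
  have hb : 0 < b := ha.trans_le hab
  -- The first bound makes the quadratic error at most half of the linear decrease; the second keeps
  -- the step shorter than `δ`, inside the neighbourhood where `L` is valid.
  refine ⟨min (a / (2 * L)) (a * δ / (G + 1)), by positivity, ?_⟩
  intro τmin τ H lam hτmin hτ hH hlam0 hstep
  have key : ∀ m, lam m ∈ K → lam (m + 1) ∈ K ∧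
      f (lam (m + 1)) ≤ f (lam m) - τmin / (2 * b) * (grad (lam m) ⬝ᵥ grad (lam m)) := by
    intro m hm
    obtain ⟨p1, p2, p3⟩ := preconditioned_step_bounds ha hab (hH m).1 (hH m).2 (grad (lam m))
    have hgm := hG _ hm
    have hz := hstep m hm.1
    have hgnn : 0 ≤ grad (lam m) ⬝ᵥ grad (lam m) := by
      simpa using dotProduct_star_self_nonneg (grad (lam m))
    set g := grad (lam m)
    set v := (H m)⁻¹ *ᵥ g
    have hτ0 : 0 < τ m := hτmin.trans_le (hτ m).1
    have ht1 : τ m * (2 * L) ≤ a := by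
      rw [← le_div_iff₀ (by positivity)]; exact (hτ m).2.trans (min_le_left _ _)
    have ht2 : τ m * (G + 1) ≤ a * δ := by
      rw [← le_div_iff₀ (by positivity)]; exact (hτ m).2.trans (min_le_right _ _)
    have hdiff : lam (m + 1) - lam m = -(τ m • v) := by rw [hz]; abel
    have hvv := sq_norm_le_dotProduct_self v
    have hnorm : ‖lam (m + 1) - lam m‖ ^ 2 = τ m ^ 2 * ‖v‖ ^ 2 := by
      rw [hdiff, norm_neg, norm_smul, mul_pow, Real.norm_eq_abs, sq_abs]
    have hdist : dist (lam (m + 1)) (lam m) ≤ δ := by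
      rw [dist_eq_norm]
      refine (sq_le_sq₀ (norm_nonneg _) hδ.le).1 ?_
      rw [hnorm]
      have s1 : a ^ 2 * (τ m ^ 2 * ‖v‖ ^ 2) ≤ a ^ 2 * δ ^ 2 := by
        calc a ^ 2 * (τ m ^ 2 * ‖v‖ ^ 2) = τ m ^ 2 * (a ^ 2 * ‖v‖ ^ 2) := by ring
          _ ≤ τ m ^ 2 * (G + 1) ^ 2 := by
              refine mul_le_mul_of_nonneg_left ?_ (sq_nonneg _)
              have := mul_le_mul_of_nonneg_left hvv (sq_nonneg a)
              nlinarith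
          _ = (τ m * (G + 1)) ^ 2 := by ring
          _ ≤ (a * δ) ^ 2 := by gcongr
          _ = a ^ 2 * δ ^ 2 := by ring
      exact le_of_mul_le_mul_left s1 (by positivity)
    have hC : lam (m + 1) ∈ Metric.cthickening δ K :=
      Metric.mem_cthickening_of_dist_le _ _ _ _ hm hdist
    have hq := hL _ (Metric.self_subset_cthickening K hm) _ hC
    rw [hnorm, hdiff, dotProduct_neg, dotProduct_smul, smul_eq_mul] at hq
    have s2 : L * (τ m ^ 2 * ‖v‖ ^ 2) ≤ τ m / 2 * (g ⬝ᵥ v) := by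
      calc L * (τ m ^ 2 * ‖v‖ ^ 2) = τ m / 2 * (τ m * (2 * L) * ‖v‖ ^ 2) := by ring
        _ ≤ τ m / 2 * (g ⬝ᵥ v) := by
          refine mul_le_mul_of_nonneg_left ?_ (by positivity)
          exact (mul_le_mul ht1 hvv (sq_nonneg _) ha.le).trans p1
    have s3 : τmin / (2 * b) * (g ⬝ᵥ g) ≤ τ m / 2 * (g ⬝ᵥ v) := by
      calc τmin / (2 * b) * (g ⬝ᵥ g) ≤ τ m / (2 * b) * (b * (g ⬝ᵥ v)) := by
            refine mul_le_mul ?_ p2 hgnn (by positivity)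
            exact div_le_div_of_nonneg_right (hτ m).1 (by positivity)
        _ = τ m / 2 * (g ⬝ᵥ v) := by field_simp
    have hfin : f (lam (m + 1)) ≤ f (lam m) - τmin / (2 * b) * (g ⬝ᵥ g) := by linarith
    refine ⟨⟨hCD hC, hfin.trans ?_⟩, hfin⟩
    have : 0 ≤ τmin / (2 * b) * (g ⬝ᵥ g) := by positivity
    linarith [hm.2]
  have hmem : ∀ m, lam m ∈ K := by
    intro m
    induction m with
    | zero => rw [hlam0]; exact ⟨hx₀, le_rfl⟩
    | succ m ih => exact (key m ih).1
  refine ⟨fun m => (hmem m).1, ?_⟩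
  have hnn : ∀ m, 0 ≤ grad (lam m) ⬝ᵥ grad (lam m) := fun m => by
    simpa using dotProduct_star_self_nonneg (grad (lam m))
  have hanti : Antitone fun m => f (lam m) := antitone_nat_of_succ_le fun m => by
    have := (key m (hmem m)).2
    have : 0 ≤ τmin / (2 * b) * (grad (lam m) ⬝ᵥ grad (lam m)) := mul_nonneg (by positivity) (hnn m)
    linarith
  obtain ⟨c, hc⟩ := hK.exists_bound_of_continuousOn (hf.mono hKD)
  have hbdd : BddBelow (Set.range fun m => f (lam m)) :=
    ⟨-c, by rintro _ ⟨m, rfl⟩; exact (abs_le.1 (hc _ (hmem m))).1⟩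
  have hlim := tendsto_atTop_ciInf hanti hbdd
  have hdiff : Filter.Tendsto (fun m => f (lam m) - f (lam (m + 1))) Filter.atTop (𝓝 0) := by
    simpa using hlim.sub (hlim.comp (Filter.tendsto_add_atTop_nat 1))
  have hgto : Filter.Tendsto (fun m => grad (lam m) ⬝ᵥ grad (lam m)) Filter.atTop (𝓝 0) := by
    have h2 := hdiff.const_mul (2 * b / τmin)
    rw [mul_zero] at h2
    refine squeeze_zero hnn (fun m => ?_) h2
    have h3 := (key m (hmem m)).2
    calc _ = 2 * b / τmin * (τmin / (2 * b) * (grad (lam m) ⬝ᵥ grad (lam m))) := by field_simp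
      _ ≤ _ := mul_le_mul_of_nonneg_left (by linarith) (by positivity)
  refine hK.tendsto_nhds_of_unique_mapClusterPt (.of_forall hmem) fun x hx hcl => ?_
  refine huniq x hx.1 hx.2 ?_
  have hcont := (hgg x hx.1).continuousAt (hD.mem_nhds hx.1)
  have hcl2 := hcl.continuousAt_comp hcont
  have : grad x ⬝ᵥ grad x = 0 := by
    by_contra hne
    obtain ⟨u, hu, w, hw, huw⟩ := Filter.disjoint_iff.1 (disjoint_nhds_nhds.2 hne)
    obtain ⟨m, hm1, hm2⟩ := ((hcl2.frequently hu).and_eventually (hgto.eventually hw)).exists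
    exact Set.disjoint_left.1 huw hm1 hm2
  exact dotProduct_self_eq_zero.1 this

end Descent

/-! ### Existence and uniqueness of the minimizer. -/

section PencilDescent
variable {ι κ : Type*} [Fintype ι] [DecidableEq ι] [Fintype κ] {r : ℕ}
  {B : Fin r → Matrix ι ι ℝ} {y : Fin r → ℝ}

theorem exists_unique_minimizer (hB : ∀ s, (B s).IsHermitian) (hli : LinearIndependent ℝ B)
    {V : Matrix κ ι ℝ} {ε : ℝ} (hε : 0 < ε)
    (hy : ∀ s, y s = (V * B s * Vᵀ).trace + ε * (B s).trace) :
    ∃ xs ∈ pencilDom B, dualGrad B y xs = 0 ∧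
      (∀ mu ∈ pencilDom B, dualValue B y xs ≤ dualValue B y mu) ∧
      (∀ mu ∈ pencilDom B, dualValue B y mu ≤ dualValue B y xs → mu = xs) := by
  have hK := isCompact_sublevel hB hli hε hy (dualValue B y 0)
  obtain ⟨xs, hxs, hmin⟩ := hK.exists_isMinOn ⟨0, zero_mem_pencilDom B, le_rfl⟩
    ((continuousOn_dualValue B y).mono fun x h => h.1)
  have hmin' : ∀ mu ∈ pencilDom B, dualValue B y xs ≤ dualValue B y mu := fun mu hmu => by
    by_cases h : dualValue B y mu ≤ dualValue B y 0
    · exact hmin ⟨hmu, h⟩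
    · exact hxs.2.trans (not_le.1 h).le
  have hloc : IsLocalMin (dualValue B y) xs := by
    filter_upwards [(isOpen_pencilDom hB).mem_nhds hxs.1] with mu hmu using hmin' mu hmu
  have hgrad : dualGrad B y xs = 0 := by
    have h0 := hloc.hasFDerivAt_eq_zero (hasFDerivAt_dualValue y hB hxs.1)
    funext s
    have := congrArg (fun T : (Fin r → ℝ) →L[ℝ] ℝ => T (Pi.single s 1)) h0
    simpa [Pi.single_apply] using this
  exact ⟨xs, hxs.1, hgrad, hmin', fun mu hmu hle => eq_of_dualGrad_eq_zero y hB hli hxs.1 hmu hgrad hle⟩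

end PencilDescent
end SOSDual
end

noncomputable section
namespace SOSDual
open MvPolynomial

/-! ### Translation between the matrix pencil and SOS decompositions. -/

section Polynomials
variable {d k r n : ℕ} {g : Fin k → MvPolynomial (Fin d) ℝ}

theorem matBAt_eq (z : Fin d → ℝ) :
    matBAt g n z = Matrix.blockDiagonal' fun j => Matrix.of fun α β : ExpIdx n (g j) =>
      eval z (g j) * (eval z (monomial α.1 1) * eval z (monomial β.1 1)) := by
  rw [matBAt, matB, Matrix.blockDiagonal'_map _ _ (map_zero _)]
  congr 1
  funext j
  ext α β
  simp only [Matrix.map_apply, Matrix.of_apply, map_mul]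

theorem matBAt_isHermitian (z : Fin d → ℝ) : (matBAt g n z).IsHermitian := by
  rw [matBAt_eq, Matrix.IsHermitian, Matrix.blockDiagonal'_conjTranspose]
  congr 1
  funext j
  ext α β
  simp only [Matrix.conjTranspose_apply, Matrix.of_apply, star_trivial]
  ring

/-- A vector `w` is a tuple of coefficient vectors, one polynomial per weight, so its form under
`B(z)` is a weighted sum of squares evaluated at `z`. -/
theorem matBAt_quadForm (z : Fin d → ℝ) (w : CholIdx g n → ℝ) :
    w ⬝ᵥ (matBAt g n z).mulVec w =
      ∑ j, eval z (g j) * (∑ α : ExpIdx n (g j), w ⟨j, α⟩ * eval z (monomial α.1 1)) ^ 2 := by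
  rw [matBAt_eq, dotProduct, Fintype.sum_sigma]
  refine Finset.sum_congr rfl fun j _ => ?_
  have hrow : ∀ α : ExpIdx n (g j), ((Matrix.blockDiagonal' fun j => Matrix.of
      fun α β : ExpIdx n (g j) =>
        eval z (g j) * (eval z (monomial α.1 1) * eval z (monomial β.1 1))).mulVec w) ⟨j, α⟩ =
      eval z (g j) * eval z (monomial α.1 1) *
        ∑ β : ExpIdx n (g j), w ⟨j, β⟩ * eval z (monomial β.1 1) := fun α => by
    rw [Matrix.mulVec, dotProduct, Fintype.sum_sigma, Finset.sum_eq_single j]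
    · rw [Finset.mul_sum]
      refine Finset.sum_congr rfl fun β _ => ?_
      rw [Matrix.blockDiagonal'_apply_eq, Matrix.of_apply]
      ring
    · intro j' _ hne
      refine Finset.sum_eq_zero fun β _ => ?_
      rw [Matrix.blockDiagonal'_apply_ne _ _ _ hne.symm, zero_mul]
    · simp
  simp only [hrow]
  rw [sq, ← mul_assoc, mul_comm (eval z (g j)), mul_assoc, Finset.sum_mul]
  exact Finset.sum_congr rfl fun α _ => by ring

theorem eval_polyB (z : Fin d → ℝ) : eval z (polyB g n) = (matBAt g n z).trace := by
  simp [polyB, matBAt, Matrix.trace]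

theorem mul_sq_mem_polySpace {f q : MvPolynomial (Fin d) ℝ}
    (h : q ≠ 0 → 2 * q.totalDegree + f.totalDegree ≤ n) : f * q ^ 2 ∈ polySpace d n := by
  by_cases hq : q = 0
  · simp [hq]
  rw [mem_restrictTotalDegree]
  have h1 := totalDegree_mul f (q ^ 2)
  have h2 := totalDegree_pow q 2
  have := h hq
  omega

theorem sos_mem_polySpace {I : Type} [Fintype I] {q : I → Fin k → MvPolynomial (Fin d) ℝ}
    (h : ∀ i j, q i j ≠ 0 → 2 * (q i j).totalDegree + (g j).totalDegree ≤ n) :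
    ∑ j, g j * ∑ i, q i j ^ 2 ∈ polySpace d n := by
  simp only [Finset.mul_sum]
  exact Submodule.sum_mem _ fun j _ => Submodule.sum_mem _ fun i _ => mul_sq_mem_polySpace (h i j)

theorem polyB_eq_sum :
    polyB g n = ∑ j, ∑ α : ExpIdx n (g j), g j * monomial α.1 1 ^ 2 := by
  simp only [polyB, Matrix.trace, Fintype.sum_sigma, matB, Matrix.diag_apply,
    Matrix.blockDiagonal'_apply_eq, Matrix.of_apply, sq]

theorem polyB_mem_polySpace : polyB g n ∈ polySpace d n := by
  rw [polyB_eq_sum]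
  refine Submodule.sum_mem _ fun j _ => Submodule.sum_mem _ fun α _ =>
    mul_sq_mem_polySpace fun _ => ?_
  rw [totalDegree_monomial _ one_ne_zero]
  exact α.2

theorem eq_sum_expIdx {f q : MvPolynomial (Fin d) ℝ}
    (h : q ≠ 0 → 2 * q.totalDegree + f.totalDegree ≤ n) :
    q = ∑ α : ExpIdx n f, monomial α.1 (coeff α.1 q) := by
  classical
  ext γ
  simp only [coeff_sum, coeff_monomial]
  by_cases hγ : 2 * γ.degree + f.totalDegree ≤ n
  · rw [Finset.sum_eq_single (⟨γ, hγ⟩ : ExpIdx n f) _ (by simp), if_pos rfl]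
    intro α _ hne
    exact if_neg fun h => hne (Subtype.ext h)
  · rw [Finset.sum_eq_zero]
    · by_contra hne
      have hq : q ≠ 0 := by rintro rfl; simp at hne
      have h1 : γ.degree ≤ q.totalDegree := le_totalDegree (mem_support_iff.2 hne)
      have := h hq
      omega
    · intro α _
      exact if_neg fun h => hγ (by rw [← h]; exact α.2)

theorem eval_eq_sum_expIdx {f q : MvPolynomial (Fin d) ℝ}
    (h : q ≠ 0 → 2 * q.totalDegree + f.totalDegree ≤ n) (z : Fin d → ℝ) :
    eval z q = ∑ α : ExpIdx n f, coeff α.1 q * eval z (monomial α.1 1) := by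
  conv_lhs => rw [eq_sum_expIdx h, map_sum]
  exact Finset.sum_congr rfl fun α _ => by simp [eval_monomial]

variable {x : Fin r → Fin d → ℝ}

theorem polyQ_degree (lam : Fin r → ℝ) (i : CholIdx g n) (j : Fin k)
    (h : polyQ g n x lam i j ≠ 0) :
    2 * (polyQ g n x lam i j).totalDegree + (g j).totalDegree ≤ n := by
  -- An available multi-index forces `deg g_j ≤ n`, which makes the truncated subtraction below
  -- harmless.
  obtain ⟨α₀, -, -⟩ := Finset.exists_ne_zero_of_sum_ne_zero h
  have h0 := α₀.2
  have : (polyQ g n x lam i j).totalDegree ≤ (n - (g j).totalDegree) / 2 := by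
    refine totalDegree_finsetSum_le fun α _ => (totalDegree_monomial_le _ _).trans ?_
    have h1 := α.2
    change α.1.degree ≤ _
    omega
  omega

theorem eval_polyQ (lam : Fin r → ℝ) (i : CholIdx g n) (j : Fin k) (z : Fin d → ℝ) :
    eval z (polyQ g n x lam i j) =
      ∑ α : ExpIdx n (g j), (matM g n x lam)⁻¹ ⟨j, α⟩ i * eval z (monomial α.1 1) := by
  rw [polyQ, map_sum]
  exact Finset.sum_congr rfl fun α _ => by simp [eval_monomial]

theorem valG_eq_dualValue (y : Fin r → ℝ) :
    valG g n x y = dualValue (fun s => matBAt g n (x s)) y := rfl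

theorem gradG_eq_dualGrad (y : Fin r → ℝ) {lam : Fin r → ℝ} (h : lam ∈ domD g n x) :
    gradG g n x y lam = dualGrad (fun s => matBAt g n (x s)) y lam := by
  funext s
  rw [gradG, valG_eq_dualValue,
    (hasFDerivAt_dualValue y (fun s => matBAt_isHermitian (x s)) h).fderiv]
  simp [Pi.single_apply]

theorem eval_sos_polyQ (lam : Fin r → ℝ) (z : Fin d → ℝ) :
    eval z (∑ j, g j * ∑ i, polyQ g n x lam i j ^ 2) =
      ((matM g n x lam)⁻¹ * matBAt g n z * (matM g n x lam)⁻¹).trace := by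
  have ht : ((matM g n x lam)⁻¹).transpose = (matM g n x lam)⁻¹ :=
    pencil_inv_transpose (fun s => matBAt_isHermitian (x s)) lam
  have h := trace_conj_eq_sum (matBAt g n z) ((matM g n x lam)⁻¹)
  rw [ht] at h
  rw [h]
  simp only [map_sum, map_mul, map_pow, Finset.mul_sum, matBAt_quadForm, eval_polyQ]
  rw [Finset.sum_comm]
  refine Finset.sum_congr rfl fun i _ => Finset.sum_congr rfl fun j _ => ?_
  congr 2
  refine Finset.sum_congr rfl fun α _ => ?_
  congr 1
  conv_lhs => rw [← ht, Matrix.transpose_apply]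

theorem continuousOn_coeff_polyQ (i : CholIdx g n) (j : Fin k) (γ : Fin d →₀ ℕ) :
    ContinuousOn (fun lam => coeff γ (polyQ g n x lam i j)) (domD g n x) := by
  classical
  simp only [polyQ, coeff_sum, coeff_monomial]
  refine continuousOn_finsetSum _ fun α _ => ?_
  split_ifs
  · exact (continuous_id.matrix_elem _ _).comp_continuousOn
      (continuousOn_pencil_inv fun s => matBAt g n (x s))
  · exact continuousOn_const

theorem descentConverges_of_unique_min
    (hli : LinearIndependent ℝ fun s => matBAt g n (x s))
    {κ : Type} [Fintype κ] {V : Matrix κ (CholIdx g n) ℝ} {ε : ℝ} (hε : 0 < ε) {y : Fin r → ℝ}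
    (hy : ∀ s, y s = (V * matBAt g n (x s) * V.transpose).trace + ε * (matBAt g n (x s)).trace)
    {xs : Fin r → ℝ} (hxs : xs ∈ domD g n x)
    (huniq : ∀ mu ∈ domD g n x, valG g n x y mu ≤ valG g n x y xs → mu = xs) :
    DescentConverges g n x y xs := by
  intro a b ha hab
  have hB : ∀ s, (matBAt g n (x s)).IsHermitian := fun s => matBAt_isHermitian (x s)
  obtain ⟨τmax, hτ, h⟩ := descent_converges (xs := xs) (isOpen_pencilDom hB)
    (continuousOn_dualValue (fun s => matBAt g n (x s)) y)
    (continuousOn_dualGrad (fun s => matBAt g n (x s)) y)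
    (zero_mem_pencilDom fun s => matBAt g n (x s)) (isCompact_sublevel hB hli hε hy _)
    (fun C hCD hC => by
      obtain ⟨L, hL0, hL⟩ := exists_remainder_bound _ hC hCD
      refine ⟨L, hL0, fun u hu v hv => ?_⟩
      rw [dualValue_expansion _ y (hCD hu) (hCD hv)]
      exact add_le_add_right ((le_abs_self _).trans (hL u hu v hv)) _)
    -- By the nonnegative remainder a critical point is a global minimizer, so it is `xs`.
    (fun u hu _ h0 => huniq u hu (dualValue_le_of_dualGrad_eq_zero y hB hu hxs h0)) ha hab
  refine ⟨τmax, hτ, fun τmin τ H lam hτmin hτm hH h0 hstep => ?_⟩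
  obtain ⟨hD, hlim⟩ := h τmin τ H lam hτmin hτm hH h0 fun m hm => by
    rw [hstep m, gradG_eq_dualGrad y hm]
  refine ⟨hD, hlim, fun i j γ => ?_⟩
  have hc := (continuousOn_coeff_polyQ (x := x) i j γ xs hxs).continuousAt
    ((isOpen_pencilDom hB).mem_nhds hxs)
  exact hc.tendsto.comp hlim

theorem minimizerYieldsSOS_of_sos (hx : IsUnisolvent n x)
    (hli : LinearIndependent ℝ fun s => matBAt g n (x s)) {I : Type} [Fintype I]
    {p : MvPolynomial (Fin d) ℝ} {q : I → Fin k → MvPolynomial (Fin d) ℝ}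
    (hq : IsSOSDecomposition g n p q) {ε : ℝ} (hε : 0 < ε) :
    MinimizerYieldsSOS g n x (p + C ε * polyB g n) := by
  have hB : ∀ s, (matBAt g n (x s)).IsHermitian := fun s => matBAt_isHermitian (x s)
  set V : Matrix I (CholIdx g n) ℝ := Matrix.of fun i a => coeff a.2.1 (q i a.1)
  set y : Fin r → ℝ := fun s => eval (x s) (p + C ε * polyB g n)
  have hy : ∀ s, y s = (V * matBAt g n (x s) * V.transpose).trace +
      ε * (matBAt g n (x s)).trace := fun s => by
    simp only [y, map_add, map_mul, eval_C, eval_polyB]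
    congr 1
    rw [trace_conj_eq_sum, hq.2]
    simp only [map_sum, map_mul, map_pow, Finset.mul_sum, matBAt_quadForm]
    rw [Finset.sum_comm]
    refine Finset.sum_congr rfl fun i _ => Finset.sum_congr rfl fun j _ => ?_
    rw [eval_eq_sum_expIdx (hq.1 i j)]
    rfl
  obtain ⟨xs, hxs, hgrad, hmin, huniq⟩ := exists_unique_minimizer hB hli hε hy
  have hfun : ∀ mu ∈ domD g n x, funG g n x y mu = (valG g n x y mu : EReal) :=
    fun mu hmu => if_pos hmu
  refine ⟨xs, hxs, fun mu hmu => ?_, fun mu hmu hm => ?_, ⟨fun i j => polyQ_degree xs i j, ?_⟩,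
    descentConverges_of_unique_min hli hε hy hxs huniq⟩
  · rw [Set.mem_ofPred_eq, hfun xs hxs, hfun mu hmu, EReal.coe_le_coe_iff]
    exact hmin mu hmu
  · refine huniq mu hmu ?_
    have h := hm hxs
    rw [Set.mem_ofPred_eq, hfun xs hxs, hfun mu hmu, EReal.coe_le_coe_iff] at h
    exact h
  · refine hx.2 _ (Submodule.add_mem _ (hq.2 ▸ sos_mem_polySpace hq.1) ?_) _
      (sos_mem_polySpace fun i j => polyQ_degree xs i j) fun s => ?_
    · rw [← smul_eq_C_mul]
      exact Submodule.smul_mem _ _ polyB_mem_polySpace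
    -- At the nodes the identity is exactly the vanishing of the gradient.
    · rw [eval_sos_polyQ]
      have := congrFun hgrad s
      exact sub_eq_zero.1 this

end Polynomials

/-! ### A Markov–Lukács theorem for positive polynomials on a segment. -/

section Lukacs
open scoped Polynomial
variable {a b : ℝ} {n : ℕ}

/-- The cone generated by the products `(X - a)^i (b - X)^j q²` whose formal degree
`i + j + 2 deg q` is at most `n` and has the parity of `n`. -/
def segCone (a b : ℝ) (n : ℕ) : AddSubmonoid ℝ[X] :=
  AddSubmonoid.closure {f | ∃ (i j t : ℕ) (q : ℝ[X]), i + j + 2 * q.natDegree + 2 * t = n ∧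
    f = (Polynomial.X - Polynomial.C a) ^ i * (Polynomial.C b - Polynomial.X) ^ j * q ^ 2}

theorem segCone_mul {m : ℕ} {f h : ℝ[X]} (hf : f ∈ segCone a b m) (hh : h ∈ segCone a b n) :
    f * h ∈ segCone a b (m + n) := by
  induction hf using AddSubmonoid.closure_induction with
  | zero => rw [zero_mul]; exact zero_mem _
  | add f₁ f₂ _ _ h₁ h₂ => rw [add_mul]; exact add_mem h₁ h₂
  | mem f hf =>
    induction hh using AddSubmonoid.closure_induction with
    | zero => rw [mul_zero]; exact zero_mem _
    | add f₁ f₂ _ _ h₁ h₂ => rw [mul_add]; exact add_mem h₁ h₂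
    | mem h hh =>
      obtain ⟨i, j, t, q, hm, rfl⟩ := hf
      obtain ⟨i', j', t', q', hn, rfl⟩ := hh
      have hd := Polynomial.natDegree_mul_le (p := q) (q := q')
      -- The slack absorbs the degree drop that occurs when `q * q'` vanishes.
      exact AddSubmonoid.subset_closure ⟨i + i', j + j',
        t + t' + (q.natDegree + q'.natDegree - (q * q').natDegree), q * q', by omega, by ring⟩

theorem C_mem_segCone_zero {c : ℝ} (hc : 0 ≤ c) : Polynomial.C c ∈ segCone a b 0 :=
  AddSubmonoid.subset_closure ⟨0, 0, 0, Polynomial.C (√c), by simp, by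
    rw [← Polynomial.C_pow, Real.sq_sqrt hc]; simp⟩

theorem X_sub_C_mem_segCone : Polynomial.X - Polynomial.C a ∈ segCone a b 1 :=
  AddSubmonoid.subset_closure ⟨1, 0, 0, 1, by simp, by simp⟩

theorem C_sub_X_mem_segCone : Polynomial.C b - Polynomial.X ∈ segCone a b 1 :=
  AddSubmonoid.subset_closure ⟨0, 1, 0, 1, by simp, by simp⟩

/-- Since `(X - a) + (b - X) = b - a`, a nonnegative constant also counts as an element of degree
one; this adjusts parity. -/
theorem C_mem_segCone_one (hab : a < b) {c : ℝ} (hc : 0 ≤ c) : Polynomial.C c ∈ segCone a b 1 := by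
  have h := segCone_mul (C_mem_segCone_zero (a := a) (b := b) (div_nonneg hc (sub_pos.2 hab).le))
    (add_mem (X_sub_C_mem_segCone (a := a) (b := b)) C_sub_X_mem_segCone)
  have e : Polynomial.X - Polynomial.C a + (Polynomial.C b - Polynomial.X) =
      Polynomial.C (b - a) := by rw [Polynomial.C_sub]; ring
  rwa [e, ← Polynomial.C_mul, div_mul_cancel₀ _ (sub_pos.2 hab).ne', zero_add] at h

theorem C_mem_segCone (hab : a < b) (n : ℕ) {c : ℝ} (hc : 0 ≤ c) :
    Polynomial.C c ∈ segCone a b n := by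
  induction n with
  | zero => exact C_mem_segCone_zero hc
  | succ n ih => simpa using segCone_mul ih (C_mem_segCone_one hab zero_le_one)

theorem sq_add_sq_mem_segCone (u v : ℝ) :
    (Polynomial.X - Polynomial.C u) ^ 2 + Polynomial.C v ^ 2 ∈ segCone a b 2 :=
  add_mem
    (AddSubmonoid.subset_closure ⟨0, 0, 0, Polynomial.X - Polynomial.C u, by simp, by simp⟩)
    (AddSubmonoid.subset_closure ⟨0, 0, 1, Polynomial.C v, by simp, by simp⟩)

/-- A weak form of the Markov–Lukács theorem, with the sharp degree bounds. -/
theorem mem_segCone_of_pos (hab : a < b) (n : ℕ) : ∀ p : ℝ[X], p.natDegree ≤ n →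
    (∀ t ∈ Set.Icc a b, 0 < p.eval t) → p ∈ segCone a b n := by
  induction n using Nat.strong_induction_on with
  | _ n ih =>
  intro p hdeg hpos
  have hp0 : p ≠ 0 := by
    rintro rfl
    simpa using hpos a (Set.left_mem_Icc.2 hab.le)
  by_cases hd : p.natDegree = 0
  · obtain ⟨c, rfl⟩ := Polynomial.natDegree_eq_zero.1 hd
    exact C_mem_segCone hab n (by simpa using (hpos a (Set.left_mem_Icc.2 hab.le)).le)
  -- Split off one real irreducible factor. A real root lies outside `[a, b]`, so up to sign its
  -- factor is `X - a` or `b - X` plus a positive constant. Without real roots, a conjugate pair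
  -- gives a factor `(X - u)² + v²`.
  by_cases hroot : ∃ t, p.IsRoot t
  · obtain ⟨t, ht⟩ := hroot
    obtain ⟨q, rfl⟩ := Polynomial.dvd_iff_isRoot.2 ht
    have hq0 : q ≠ 0 := right_ne_zero_of_mul hp0
    rw [Polynomial.natDegree_mul (Polynomial.X_sub_C_ne_zero t) hq0, Polynomial.natDegree_X_sub_C]
      at hdeg
    have hev : ∀ u ∈ Set.Icc a b, 0 < (u - t) * q.eval u := fun u hu => by simpa using hpos u hu
    have hn : n - 1 + 1 = n := by omega
    by_cases hta : t < a
    · have hq := ih (n - 1) (by omega) q (by omega) fun u hu =>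
        pos_of_mul_pos_right (hev u hu) (by linarith [hu.1])
      have hl : Polynomial.X - Polynomial.C t ∈ segCone a b 1 := by
        have := add_mem (X_sub_C_mem_segCone (a := a) (b := b))
          (C_mem_segCone_one hab (sub_nonneg.2 hta.le))
        rwa [Polynomial.C_sub, sub_add_sub_cancel] at this
      rw [← hn, mul_comm]
      exact segCone_mul hq hl
    · have htb : b < t := by
        by_contra hle
        have := hev t ⟨not_lt.1 hta, not_lt.1 hle⟩
        simp at this
      have hq := ih (n - 1) (by omega) (-q) (by rw [Polynomial.natDegree_neg]; omega) fun u hu => by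
        rw [Polynomial.eval_neg]
        have h1 := hev u hu
        have h2 : u - t < 0 := by linarith [hu.2]
        linarith [neg_of_mul_pos_right h1 h2.le]
      have hl : Polynomial.C t - Polynomial.X ∈ segCone a b 1 := by
        have := add_mem (C_mem_segCone_one (a := a) hab (sub_nonneg.2 htb.le))
          (C_sub_X_mem_segCone (a := a) (b := b))
        rwa [Polynomial.C_sub, sub_add_sub_cancel] at this
      have e : (Polynomial.X - Polynomial.C t) * q = -q * (Polynomial.C t - Polynomial.X) := by ring
      rw [← hn, e]
      exact segCone_mul hq hl
  · obtain ⟨z, hz⟩ := IsAlgClosed.exists_aeval_eq_zero ℂ p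
      (fun h => hd (Polynomial.natDegree_eq_of_degree_eq_some h))
    have him : z.im ≠ 0 := fun h => hroot ⟨z.re, by
      have hzr : z = ((z.re : ℝ) : ℂ) := Complex.ext rfl (by simp [h])
      rw [hzr, ← Complex.coe_algebraMap, Polynomial.aeval_algebraMap_apply] at hz
      simpa using hz⟩
    obtain ⟨q, hq⟩ := p.quadratic_dvd_of_aeval_eq_zero_im_ne_zero hz him
    have hquad : Polynomial.X ^ 2 - Polynomial.C (2 * z.re) * Polynomial.X +
        Polynomial.C (‖z‖ ^ 2) =
        (Polynomial.X - Polynomial.C z.re) ^ 2 + Polynomial.C z.im ^ 2 := by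
      rw [Complex.sq_norm, Complex.normSq_apply]
      simp only [Polynomial.C_add, Polynomial.C_mul, map_ofNat]
      ring
    rw [hquad] at hq
    have hq0 : q ≠ 0 := by rintro rfl; simp [hp0] at hq
    have hdq : ((Polynomial.X - Polynomial.C z.re) ^ 2 + Polynomial.C z.im ^ 2).natDegree = 2 := by
      rw [← Polynomial.C_pow]; compute_degree!
    have hne : (Polynomial.X - Polynomial.C z.re) ^ 2 + Polynomial.C z.im ^ 2 ≠ 0 := by
      intro h; rw [h] at hdq; simp at hdq
    have hdeg2 : 2 + q.natDegree ≤ n := by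
      rw [hq, Polynomial.natDegree_mul hne hq0, hdq] at hdeg; exact hdeg
    have hqm := ih (n - 2) (by omega) q (by omega) fun u hu => by
      have h1 := hpos u hu
      rw [hq, Polynomial.eval_mul] at h1
      refine pos_of_mul_pos_right h1 ?_
      simp only [Polynomial.eval_add, Polynomial.eval_pow, Polynomial.eval_sub, Polynomial.eval_X,
        Polynomial.eval_C]
      positivity
    have hn : 2 + (n - 2) = n := by omega
    rw [hq, ← hn]
    exact segCone_mul (sq_add_sq_mem_segCone _ _) hqm

end Lukacs

/-! ### Assembling SOS decompositions. -/

section SOSCone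
variable {d k n : ℕ} {g : Fin k → MvPolynomial (Fin d) ℝ}

theorem isSOSDecomposition_zero :
    IsSOSDecomposition g n 0 (fun (_ : Empty) _ => (0 : MvPolynomial (Fin d) ℝ)) :=
  ⟨fun i => i.elim, by simp⟩

theorem IsSOSDecomposition.add {I J : Type} [Fintype I] [Fintype J] {p p' : MvPolynomial (Fin d) ℝ}
    {q : I → Fin k → MvPolynomial (Fin d) ℝ} {q' : J → Fin k → MvPolynomial (Fin d) ℝ}
    (h : IsSOSDecomposition g n p q) (h' : IsSOSDecomposition g n p' q') :
    IsSOSDecomposition g n (p + p') (Sum.elim q q') := by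
  refine ⟨?_, ?_⟩
  · rintro (i | i) j
    · exact h.1 i j
    · exact h'.1 i j
  · rw [h.2, h'.2, ← Finset.sum_add_distrib]
    exact Finset.sum_congr rfl fun j _ => by simp [Fintype.sum_sum_type, mul_add]

theorem exists_isSOSDecomposition_of_eq_mul_sq {j : Fin k} {p q : MvPolynomial (Fin d) ℝ}
    (h : 2 * q.totalDegree + (g j).totalDegree ≤ n) (hp : p = g j * q ^ 2) :
    ∃ q' : Unit → Fin k → MvPolynomial (Fin d) ℝ, IsSOSDecomposition g n p q' := by
  refine ⟨fun _ => Pi.single j q, fun _ j' hne => ?_, ?_⟩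
  · by_cases hj : j' = j
    · subst hj; simpa using h
    · simp [hj] at hne
  · rw [hp, Finset.sum_eq_single j]
    · simp
    · intro j' _ hj; simp [hj]
    · simp

end SOSCone

/-! ### The univariate case on a segment. -/

section Segment
open scoped Polynomial
variable {a b : ℝ} {n : ℕ}

theorem totalDegree_aeval_X_le (q : ℝ[X]) :
    (Polynomial.aeval (X 0 : MvPolynomial (Fin 1) ℝ) q).totalDegree ≤ q.natDegree := by
  rw [Polynomial.aeval_eq_sum_range]
  refine totalDegree_finsetSum_le fun i hi => (totalDegree_smul_le _ _).trans ?_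
  refine (totalDegree_pow _ _).trans ?_
  rw [totalDegree_X, mul_one]
  exact Nat.lt_succ_iff.1 (Finset.mem_range.1 hi)

theorem totalDegree_X_sub_C_le (c : ℝ) :
    ((X 0 : MvPolynomial (Fin 1) ℝ) - C c).totalDegree ≤ 1 :=
  (totalDegree_sub _ _).trans (by simp)

theorem totalDegree_C_sub_X_le (c : ℝ) :
    (C c - (X 0 : MvPolynomial (Fin 1) ℝ)).totalDegree ≤ 1 :=
  (totalDegree_sub _ _).trans (by simp)

theorem segWeights_of_even (a b : ℝ) (hn : Even n) :
    segWeights n a b 0 = 1 ∧ segWeights n a b 1 = (X 0 - C a) * (C b - X 0) := by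
  rw [segWeights, if_pos hn]; exact ⟨rfl, rfl⟩

theorem segWeights_of_odd (a b : ℝ) (hn : Odd n) :
    segWeights n a b 0 = X 0 - C a ∧ segWeights n a b 1 = C b - X 0 := by
  rw [segWeights, if_neg (Nat.not_even_iff_odd.2 hn)]; exact ⟨rfl, rfl⟩

/-- Even parts of the exponents go into the square. As `i + j` has the parity of `n`, the leftover
factor is `1` or `(X - a)(b - X)` for even `n`, and `X - a` or `b - X` for odd `n`: precisely the
weights. -/
theorem exists_segWeights_decomposition_of_generator (i j t : ℕ) (q : ℝ[X])
    (h : i + j + 2 * q.natDegree + 2 * t = n) :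
    ∃ q' : Unit → Fin 2 → MvPolynomial (Fin 1) ℝ, IsSOSDecomposition (segWeights n a b) n
      (Polynomial.aeval (X 0) ((Polynomial.X - Polynomial.C a) ^ i *
        (Polynomial.C b - Polynomial.X) ^ j * q ^ 2)) q' := by
  set f : ℝ[X] := (Polynomial.X - Polynomial.C a) ^ (i / 2) *
    (Polynomial.C b - Polynomial.X) ^ (j / 2) * q
  have hf : f.natDegree ≤ i / 2 + j / 2 + q.natDegree := by
    refine Polynomial.natDegree_mul_le.trans (add_le_add_left
      (Polynomial.natDegree_mul_le.trans (add_le_add ?_ ?_)) _)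
    · exact Polynomial.natDegree_pow_le.trans (by rw [Polynomial.natDegree_X_sub_C, mul_one])
    · refine Polynomial.natDegree_pow_le.trans ?_
      have : (Polynomial.C b - Polynomial.X).natDegree ≤ 1 := by compute_degree
      simpa using Nat.mul_le_mul_left (j / 2) this
  have hF := (totalDegree_aeval_X_le f).trans hf
  have hsplit : (Polynomial.X - Polynomial.C a) ^ i * (Polynomial.C b - Polynomial.X) ^ j * q ^ 2 =
      (Polynomial.X - Polynomial.C a) ^ (i % 2) * (Polynomial.C b - Polynomial.X) ^ (j % 2) *
        f ^ 2 := by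
    conv_lhs => rw [← Nat.mod_add_div i 2, ← Nat.mod_add_div j 2]
    simp only [f]
    ring
  have hval : Polynomial.aeval (X 0 : MvPolynomial (Fin 1) ℝ) ((Polynomial.X - Polynomial.C a) ^ i *
        (Polynomial.C b - Polynomial.X) ^ j * q ^ 2) =
      (X 0 - C a) ^ (i % 2) * (C b - X 0) ^ (j % 2) * Polynomial.aeval (X 0) f ^ 2 := by
    rw [hsplit]
    simp [MvPolynomial.algebraMap_eq]
  have h1 := totalDegree_X_sub_C_le a
  have h2 := totalDegree_C_sub_X_le b
  have h3 := totalDegree_mul ((X 0 : MvPolynomial (Fin 1) ℝ) - C a) (C b - X 0)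
  rw [hval]
  rcases Nat.even_or_odd n with hn | hn
  · obtain ⟨w0, w1⟩ := segWeights_of_even a b hn
    have hn2 := Nat.even_iff.1 hn
    rcases Nat.mod_two_eq_zero_or_one i with hi | hi
    · have hj : j % 2 = 0 := by omega
      refine exists_isSOSDecomposition_of_eq_mul_sq (j := 0) (q := Polynomial.aeval (X 0) f) ?_ ?_
      · rw [w0, totalDegree_one]; omega
      · rw [w0, hi, hj, pow_zero, pow_zero, one_mul]
    · have hj : j % 2 = 1 := by omega
      refine exists_isSOSDecomposition_of_eq_mul_sq (j := 1) (q := Polynomial.aeval (X 0) f) ?_ ?_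
      · rw [w1]; omega
      · rw [w1, hi, hj, pow_one, pow_one]
  · obtain ⟨w0, w1⟩ := segWeights_of_odd a b hn
    have hn2 := Nat.odd_iff.1 hn
    rcases Nat.mod_two_eq_zero_or_one i with hi | hi
    · have hj : j % 2 = 1 := by omega
      refine exists_isSOSDecomposition_of_eq_mul_sq (j := 1) (q := Polynomial.aeval (X 0) f) ?_ ?_
      · rw [w1]; omega
      · rw [w1, hi, hj, pow_zero, pow_one, one_mul]
    · have hj : j % 2 = 0 := by omega
      refine exists_isSOSDecomposition_of_eq_mul_sq (j := 0) (q := Polynomial.aeval (X 0) f) ?_ ?_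
      · rw [w0]; omega
      · rw [w0, hi, hj, pow_zero, pow_one, mul_one]

theorem exists_segWeights_decomposition {p : ℝ[X]} (hp : p ∈ segCone a b n) :
    ∃ (I : Type) (_ : Fintype I) (q : I → Fin 2 → MvPolynomial (Fin 1) ℝ),
      IsSOSDecomposition (segWeights n a b) n (Polynomial.aeval (X 0) p) q := by
  induction hp using AddSubmonoid.closure_induction with
  | zero => exact ⟨Empty, inferInstance, _, by rw [map_zero]; exact isSOSDecomposition_zero⟩
  | add p p' _ _ h h' =>
    obtain ⟨I, _, q, hq⟩ := h
    obtain ⟨J, _, q', hq'⟩ := h'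
    exact ⟨I ⊕ J, inferInstance, _, by rw [map_add]; exact hq.add hq'⟩
  | mem p h =>
    obtain ⟨i, j, t, q, hn, rfl⟩ := h
    obtain ⟨q', hq'⟩ := exists_segWeights_decomposition_of_generator i j t q hn
    exact ⟨Unit, inferInstance, q', hq'⟩

theorem aeval_aeval_X (p : MvPolynomial (Fin 1) ℝ) :
    Polynomial.aeval (X 0 : MvPolynomial (Fin 1) ℝ)
      (aeval (fun _ : Fin 1 => (Polynomial.X : ℝ[X])) p) = p := by
  have : ((Polynomial.aeval (X 0 : MvPolynomial (Fin 1) ℝ)).comp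
      (aeval fun _ : Fin 1 => (Polynomial.X : ℝ[X]))) = AlgHom.id ℝ _ := by
    refine MvPolynomial.algHom_ext fun i => ?_
    simp [Subsingleton.elim i 0]
  exact DFunLike.congr_fun this p

theorem eval_aeval_X (p : MvPolynomial (Fin 1) ℝ) (t : ℝ) :
    (aeval (fun _ : Fin 1 => (Polynomial.X : ℝ[X])) p).eval t = eval (fun _ => t) p := by
  have : ((Polynomial.aeval t).comp (aeval fun _ : Fin 1 => (Polynomial.X : ℝ[X]))) =
      aeval (fun _ : Fin 1 => t) := by
    refine MvPolynomial.algHom_ext fun i => ?_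
    simp
  simpa [aeval_eq_eval] using DFunLike.congr_fun this p

theorem natDegree_aeval_X_le {p : MvPolynomial (Fin 1) ℝ} (hp : p ∈ polySpace 1 n) :
    (aeval (fun _ : Fin 1 => (Polynomial.X : ℝ[X])) p).natDegree ≤ n := by
  rw [mem_restrictTotalDegree] at hp
  simpa using aeval_natDegree_le p hp (fun _ => (Polynomial.X : ℝ[X])) (n := 1)
    (fun _ => Polynomial.natDegree_X_le)

/-- Evaluation at the nodes is injective by counting roots and surjective by Lagrange interpolation;
this also yields the dimension. -/
theorem isUnisolvent_of_injective {x : Fin (n + 1) → Fin 1 → ℝ} (hx : Function.Injective x) :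
    IsUnisolvent n x := by
  have hx0 : Function.Injective fun s => x s 0 := fun s t h =>
    hx (funext fun i => by rw [Subsingleton.elim i 0]; exact h)
  have hxc : ∀ s, x s = fun _ => x s 0 := fun s => funext fun i => by rw [Subsingleton.elim i 0]
  have hinj : ∀ p ∈ polySpace 1 n, (∀ s, eval (x s) p = 0) → p = 0 := fun p hp h => by
    have h0 : aeval (fun _ : Fin 1 => (Polynomial.X : ℝ[X])) p = 0 :=
      Polynomial.eq_zero_of_natDegree_lt_card_of_eval_eq_zero _ hx0
        (fun s => by rw [eval_aeval_X, ← hxc, h s])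
        (by rw [Fintype.card_fin]; exact Nat.lt_succ_of_le (natDegree_aeval_X_le hp))
    rw [← aeval_aeval_X p, h0, map_zero]
  set E : polySpace 1 n →ₗ[ℝ] (Fin (n + 1) → ℝ) :=
    (LinearMap.pi fun s => (aeval (x s)).toLinearMap).comp (polySpace 1 n).subtype
  have hE : ∀ p s, E p s = eval (x s) p.1 := fun p s => by simp [E, aeval_eq_eval]
  have hEinj : Function.Injective E := by
    rw [← LinearMap.ker_eq_bot, LinearMap.ker_eq_bot']
    intro p hp
    exact Subtype.ext (hinj p.1 p.2 fun s => by rw [← hE, hp]; rfl)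
  have hEsurj : Function.Surjective E := fun y => by
    set f := Lagrange.interpolate Finset.univ (fun s => x s 0) y
    have hdeg : f.natDegree ≤ n := by
      have := Lagrange.degree_interpolate_lt (s := Finset.univ) y hx0.injOn
      rw [Finset.card_univ, Fintype.card_fin] at this
      exact Polynomial.natDegree_le_of_degree_le (Order.lt_succ_iff.1 this)
    refine ⟨⟨Polynomial.aeval (X 0) f, ?_⟩, ?_⟩
    · rw [mem_restrictTotalDegree]
      exact (totalDegree_aeval_X_le f).trans hdeg
    · funext s
      rw [hE]
      have h1 : eval (x s) (Polynomial.aeval (X 0 : MvPolynomial (Fin 1) ℝ) f) =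
          f.eval (x s 0) := by
        have := Polynomial.aeval_algHom_apply (aeval (x s) : MvPolynomial (Fin 1) ℝ →ₐ[ℝ] ℝ) (X 0) f
        simpa [aeval_eq_eval] using this.symm
      rw [h1]
      exact Lagrange.eval_interpolate_at_node y hx0.injOn (Finset.mem_univ s)
  refine ⟨?_, fun p hp q hq h => sub_eq_zero.1 (hinj _ (Submodule.sub_mem _ hp hq) fun s => by
    rw [map_sub, h s, sub_self])⟩
  rw [(LinearEquiv.ofBijective E ⟨hEinj, hEsurj⟩).finrank_eq]
  simp

theorem linearIndependent_segWeights (hab : a < b) {x : Fin (n + 1) → Fin 1 → ℝ}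
    (hx : Function.Injective x) :
    LinearIndependent ℝ fun s => matBAt (segWeights n a b) n (x s) := by
  have hx0 : Function.Injective fun s => x s 0 := fun s t h =>
    hx (funext fun i => by rw [Subsingleton.elim i 0]; exact h)
  rw [Fintype.linearIndependent_iff]
  intro c hc
  have hentry : ∀ (j : Fin 2) (u v : ℕ),
      2 * u + (segWeights n a b j).totalDegree ≤ n →
      2 * v + (segWeights n a b j).totalDegree ≤ n →
      ∑ s, c s * (eval (x s) (segWeights n a b j) * x s 0 ^ (u + v)) = 0 := by
    intro j u v hu hv
    have h := congrFun (congrFun hc ⟨j, ⟨Finsupp.single 0 u, by simpa using hu⟩⟩)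
      ⟨j, ⟨Finsupp.single 0 v, by simpa using hv⟩⟩
    simp only [Matrix.sum_apply, Matrix.smul_apply, matBAt_eq, Matrix.blockDiagonal'_apply_eq,
      Matrix.of_apply, smul_eq_mul, Matrix.zero_apply, eval_monomial, one_mul] at h
    rw [← h]
    refine Finset.sum_congr rfl fun s _ => ?_
    simp [Finsupp.prod_single_index, pow_add]
  -- All moments up to `n` vanish, which contradicts Vandermonde unless `c = 0`. For odd `n`, the
  -- two blocks say that the next moment is both `a` and `b` times the current one, so the latter is
  -- zero; the top moment follows from the one before.
  have hpow : ∀ m ≤ n, ∑ s, c s * x s 0 ^ m = 0 := by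
    rcases Nat.even_or_odd n with hn | hn
    · obtain ⟨w0, -⟩ := segWeights_of_even a b hn
      have hn2 := Nat.even_iff.1 hn
      intro m hm
      have h := hentry 0 (m / 2) (m - m / 2) (by rw [w0, totalDegree_one]; omega)
        (by rw [w0, totalDegree_one]; omega)
      rw [Nat.add_sub_of_le (Nat.div_le_self m 2)] at h
      simpa [w0] using h
    · obtain ⟨w0, w1⟩ := segWeights_of_odd a b hn
      have hn2 := Nat.odd_iff.1 hn
      have h1 := totalDegree_X_sub_C_le a
      have h2 := totalDegree_C_sub_X_le b
      have hA : ∀ m < n, ∑ s, c s * x s 0 ^ (m + 1) = a * ∑ s, c s * x s 0 ^ m := fun m hm => by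
        have h := hentry 0 (m / 2) (m - m / 2) (by rw [w0]; omega) (by rw [w0]; omega)
        rw [Nat.add_sub_of_le (Nat.div_le_self m 2)] at h
        simp only [w0, map_sub, eval_X, eval_C] at h
        rw [Finset.mul_sum, ← sub_eq_zero, ← Finset.sum_sub_distrib, ← h]
        exact Finset.sum_congr rfl fun s _ => by ring
      have hB : ∀ m < n, ∑ s, c s * x s 0 ^ (m + 1) = b * ∑ s, c s * x s 0 ^ m := fun m hm => by
        have h := hentry 1 (m / 2) (m - m / 2) (by rw [w1]; omega) (by rw [w1]; omega)
        rw [Nat.add_sub_of_le (Nat.div_le_self m 2)] at h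
        simp only [w1, map_sub, eval_X, eval_C] at h
        rw [Finset.mul_sum, ← sub_eq_zero, ← Finset.sum_sub_distrib, ← neg_eq_zero, ← h,
          ← Finset.sum_neg_distrib]
        exact Finset.sum_congr rfl fun s _ => by ring
      have hlow : ∀ m < n, ∑ s, c s * x s 0 ^ m = 0 := fun m hm => by
        have h : (b - a) * ∑ s, c s * x s 0 ^ m = 0 := by
          rw [sub_mul, ← hA m hm, ← hB m hm, sub_self]
        exact (mul_eq_zero.1 h).resolve_left (sub_pos.2 hab).ne'
      intro m hm
      rcases hm.lt_or_eq with hlt | rfl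
      · exact hlow m hlt
      · have h := hA (m - 1) (by omega)
        rwa [hlow (m - 1) (by omega), mul_zero, Nat.sub_add_cancel (by omega)] at h
  intro s
  exact congrFun (Matrix.eq_zero_of_forall_pow_sum_mul_pow_eq_zero (f := fun s => x s 0) (v := c)
    hx0 fun i => hpow i (Nat.lt_succ_iff.1 i.2)) s

theorem minimizerYieldsSOS_segment (hab : a < b) {x : Fin (n + 1) → Fin 1 → ℝ}
    (hx : Function.Injective x) {p : MvPolynomial (Fin 1) ℝ} (hp : p ∈ polySpace 1 n)
    (hpos : ∀ t ∈ Set.Icc a b, 0 < eval (fun _ => t) p) :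
    MinimizerYieldsSOS (segWeights n a b) n x p := by
  set w := polyB (segWeights n a b) n
  have hcont : ∀ f : MvPolynomial (Fin 1) ℝ, Continuous fun t : ℝ => eval (fun _ => t) f :=
    fun f => (continuous_eval f).comp (continuous_pi fun _ => continuous_id)
  obtain ⟨t₀, ht₀, hmin⟩ := (isCompact_Icc (a := a) (b := b)).exists_isMinOn
    (Set.nonempty_Icc.2 hab.le) (hcont p).continuousOn
  obtain ⟨W, hW⟩ := (isCompact_Icc (a := a) (b := b)).exists_bound_of_continuousOn
    (hcont w).continuousOn
  have hm := hpos t₀ ht₀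
  set m := eval (fun _ => t₀) p
  -- Chosen so that `ε p_B` stays strictly below the minimum `m` of `p` on the segment.
  set ε := m / (|W| + 1)
  have hε : 0 < ε := by positivity
  have hsub : p - C ε * w ∈ polySpace 1 n := by
    rw [← smul_eq_C_mul]
    exact Submodule.sub_mem _ hp (Submodule.smul_mem _ _ polyB_mem_polySpace)
  have hcone := mem_segCone_of_pos hab n _ (natDegree_aeval_X_le hsub) fun t ht => by
    rw [eval_aeval_X, map_sub, map_mul, eval_C, sub_pos]
    have h1 : eval (fun _ => t) w ≤ |W| :=
      (le_abs_self _).trans ((hW t ht).trans (le_abs_self _))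
    calc ε * eval (fun _ => t) w ≤ ε * |W| := by gcongr
      _ < ε * (|W| + 1) := by gcongr; linarith
      _ = m := div_mul_cancel₀ _ (by positivity)
      _ ≤ eval (fun _ => t) p := hmin ht
  obtain ⟨I, _, q, hq⟩ := exists_segWeights_decomposition hcone
  rw [aeval_aeval_X] at hq
  have := minimizerYieldsSOS_of_sos (isUnisolvent_of_injective hx)
    (linearIndependent_segWeights hab hx) hq hε
  rwa [sub_add_cancel] at this

end Segment
end SOSDual
end

theorem mainTheorem3 :
    (∀ (d n k r : ℕ) (g : Fin k → MvPolynomial (Fin d) ℝ) (x : Fin r → Fin d → ℝ)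
        (p : MvPolynomial (Fin d) ℝ),
        SOSDual.IsUnisolvent n x →
        LinearIndependent ℝ (fun s => SOSDual.matBAt g n (x s)) →
        p ∈ SOSDual.nonnegPolys n (SOSDual.semialgSet g) →
        (∃ (N : ℕ) (q : Fin N → Fin k → MvPolynomial (Fin d) ℝ),
          SOSDual.IsSOSDecomposition g n p q) →
        ∀ ε : ℝ, 0 < ε →
          SOSDual.MinimizerYieldsSOS g n x (p + MvPolynomial.C ε * SOSDual.polyB g n)) ∧
    (∀ (n : ℕ) (a b : ℝ) (x : Fin (n + 1) → Fin 1 → ℝ) (p : MvPolynomial (Fin 1) ℝ),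
        a < b → Function.Injective x →
        p ∈ SOSDual.polySpace 1 n →
        (∀ t ∈ Set.Icc a b, 0 < MvPolynomial.eval (fun _ => t) p) →
        SOSDual.MinimizerYieldsSOS (SOSDual.segWeights n a b) n x p) :=
  ⟨fun _ _ _ _ _ _ _ hx hli _ ⟨_, _, hq⟩ _ hε =>
    SOSDual.minimizerYieldsSOS_of_sos hx hli hq hε,
    fun _ _ _ _ _ hab hx hp hpos => SOSDual.minimizerYieldsSOS_segment hab hx hp hpos⟩
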